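/- **Setting.** Let $Q=\{1,\dots,N\}$, $N\ge 1$, fix an initial state $q_0\in Q$, and let $\theta\in\mathbb N^{N\times N}$ with all $\theta_{ij}\ge 1$. The unknown transition matrix $M$ of a Markov chain on $Q$ started at $q_0$ has the matrix beta prior with density $$p_\theta(M)=\prod_{i}\frac{\Gamma(\sum_j\theta_{ij})}{\prod_j\Gamma(\theta_{ij})}\prod_{i,j}M_{ij}^{\theta_{ij}-1}$$ with respect to Lebesgue measure on the stochastic $N\times N$ matrices (each row parametrized by $N-1$ of its coordinates). For a word $\vec x=x_0\dots x_m$ with $x_0=q_0$, the posterior $\mathbb P_\theta(\cdot\mid\vec x)$ has, by Bayes' rule, density proportional to $p_\theta(M)\prod_{t<m}M_{x_tx_{t+1}}$. A path of a Markov chain is a nonempty word $x_0\dots x_m$ with $\mathbb P(X_t=x_t)>0$ for every $t$. An expression $\varphi$ is generated by $\xi::=v_{ij}\mid\xi\cdot\xi\mid 1\div\xi$ and $\varphi::=\kappa\in\mathbb R\mid\xi\mid\varphi+\varphi\mid\varphi-\varphi\mid\varphi\cdot\varphi$; $\varphi(M)$ is its value at $v_{ij}=M_{ij}$. Expanding $\varphi$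 gives its polynomial form $\sum_l\kappa_l\prod_{i,j}v_{ij}^{d^l_{ij}}$ with $d^l_{ij}\in\mathbb Z$. Let $0<\delta\le 1$. A *monitor* is a randomized register monitor: it has finitely many registers holding natural numbers, all $0$ at the start; on each input symbol it selects the unique applicable test (a conjunction of atomic formulas and negations over $0,1,+,-,\times,\div,\le,=$ in the registers), draws at random an update (an assignment of terms over $0,1,+,-,\times,\div$ to the registers) and performs it; its output is a function of the registers, here a real interval or $\bot$ ("no estimate yet", which excludes no value). It *solves the Bayesian monitoring problem* for $(Q,\varphi,\delta)$ if for every Markov chain on $Q$ started at $q_0$ and every finite path $\vec x$ of it, its output on $\vec x$ contains $\varphi(M)$ with probability at least $1-\delta$ given $\vec x$, jointly over the posterior of $M$ and the monitor's own independent randomness. **The algorithm.** For a polynomial form with exponents $d^l$ put $d^l_i=\sum_jd^l_{ij}$. BayesExpMonitor initializes on the first symbol counters $\bar c_{ij}=\theta_{ij}$, $\bar c_i=\sum_j\theta_{ij}$ and is inactive. On each further symbol $\sigma'$ with previous state $\sigma$ it increments $\bar c_{\sigma\sigma'}$ and $\bar c_\sigma$. If it is inactive and $\bar c_{ij}+\min_l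 d^l_{ij}>0$ for every variable $v_{ij}$ that occurs, it becomes active and sets, for each $l$, $$h^l=\frac{\prod_i\prod_{j:\,d^l_{ij}>0}P(\bar c_{ij}-1+|d^l_{ij}|,|d^l_{ij}|)}{\prod_{i:\,d^l_i>0}P(\bar c_i-1+|d^l_i|,|d^l_i|)}\cdot\frac{\prod_{i:\,d^l_i<0}P(\bar c_i-1,|d^l_i|)}{\prod_i\prod_{j:\,d^l_{ij}<0}P(\bar c_{ij}-1,|d^l_{ij}|)},\qquad P(a,k)=\frac{a!}{(a-k)!};$$ if it was active before, it multiplies $h^l$ by $\frac{\bar c_{\sigma\sigma'}-1+d^l_{\sigma\sigma'}}{\bar c_{\sigma\sigma'}-1}\cdot\frac{\bar c_\sigma-1}{\bar c_\sigma-1+d^l_\sigma}$. Its value is $\sum_l\kappa_lh^l$ if active and $\bot$ otherwise. BayesConfIntMonitor runs it on the polynomial forms of $\varphi$ and of $\varphi^2=\varphi\cdot\varphi$ in parallel; with values $E$, $E_2$ its output is $[E\pm\sqrt{(E_2-E^2)/\delta}]$, or $\bot$ if one of them is $\bot$. **Theorem.** The prior is a probability measure, and BayesConfIntMonitor is a register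 monitor that solves the Bayesian monitoring problem for $(Q,\varphi,\delta)$ with this prior. More precisely, let $\vec x$ be a finite path of a Markov chain on $Q$ started at $q_0$, and let $c_{ij}(\vec x)$ be the number of transitions from $i$ to $j$ in $\vec x$. The posterior given $\vec x$ is a probability measure. If $\vec x$ has at least one transition and $c_{ij}(\vec x)+\theta_{ij}+d_{ij}>0$ for all $i,j$ and for the exponents $d$ of every monomial in the polynomial forms of $\varphi$ and of $\varphi^2$, then $\varphi(M)$ is square-integrable under the posterior, the output of the monitor on $\vec x$ is, with probability one, the interval $$\Big[E-\sqrt{V/\delta},\ E+\sqrt{V/\delta}\Big],\qquad E=\mathbb E_\theta(\varphi(M)\mid\vec x),\quad V=\mathrm{Var}_\theta(\varphi(M)\mid\vec x),$$ and $\mathbb P_\theta\big(\varphi(M)\in[E-\sqrt{V/\delta},E+\sqrt{V/\delta}]\mid\vec x\big)\ge 1-\delta$. Otherwise the output is $\bot$. -/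

import Mathlib

open MeasureTheory ProbabilityTheory

open scoped ENNReal

namespace BayesMonitor

/-! ### Finite Markov chains -/

/-- A finite Markov chain with states `Fin N`: a transition matrix whose rows lie in the
probability simplex, and a distribution of the initial state. -/
structure MarkovChain (N : ℕ) where
  trans : Matrix (Fin N) (Fin N) ℝ
  trans_mem : ∀ i, trans i ∈ stdSimplex ℝ (Fin N)
  init : Fin N → ℝ
  init_mem : init ∈ stdSimplex ℝ (Fin N)

/-- `C.marginal t j` is the probability of `X_t = j`. -/
noncomputable def MarkovChain.marginal {N : ℕ} (C : MarkovChain N) (t : ℕ) : Fin N → ℝ :=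
  Matrix.vecMul C.init (C.trans ^ t)

/-- A finite path of the chain: a word `x_0 … x_m` with `P(X_t = x_t) > 0` for every `t`. -/
def MarkovChain.IsPath {N : ℕ} (C : MarkovChain N) (x : List (Fin N)) : Prop :=
  x ≠ [] ∧ ∀ (t : ℕ) (h : t < x.length), 0 < C.marginal t x[t]

/-- The chain starts in the state `q₀` almost surely. -/
def MarkovChain.StartsAt {N : ℕ} (C : MarkovChain N) (q₀ : Fin N) : Prop :=
  C.init = Pi.single q₀ 1

/-! ### Probabilistic specification expressions -/

/-- `ξ ::= v_{ij} | ξ · ξ | 1 ÷ ξ` -/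
inductive Monomial (Q : Type) : Type
  | var (i j : Q) : Monomial Q
  | mul (ξ η : Monomial Q) : Monomial Q
  | inv (ξ : Monomial Q) : Monomial Q

/-- `φ ::= κ | ξ | φ + φ | φ - φ | φ · φ` -/
inductive PSE (Q : Type) : Type
  | const (κ : ℝ) : PSE Q
  | mono (ξ : Monomial Q) : PSE Q
  | add (φ ψ : PSE Q) : PSE Q
  | sub (φ ψ : PSE Q) : PSE Q
  | mul (φ ψ : PSE Q) : PSE Q

noncomputable def Monomial.eval {Q : Type} : Monomial Q → (Q → Q → ℝ) → ℝ
  | .var i j, M => M i j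
  | .mul ξ η, M => ξ.eval M * η.eval M
  | .inv ξ, M => 1 / ξ.eval M

/-- The value `φ(M)`. -/
noncomputable def PSE.eval {Q : Type} : PSE Q → (Q → Q → ℝ) → ℝ
  | .const κ, _ => κ
  | .mono ξ, M => ξ.eval M
  | .add φ ψ, M => φ.eval M + ψ.eval M
  | .sub φ ψ, M => φ.eval M - ψ.eval M
  | .mul φ ψ, M => φ.eval M * ψ.eval M

/-- The integer exponent `d_{ab}` of the variable `v_{ab}` in a monomial. -/
def Monomial.exponent {Q : Type} [DecidableEq Q] : Monomial Q → Q → Q → ℤ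
  | .var i j, a, b => if a = i ∧ b = j then 1 else 0
  | .mul ξ η, a, b => ξ.exponent a b + η.exponent a b
  | .inv ξ, a, b => - ξ.exponent a b

/-- An expression in polynomial form `∑_l κ_l ξ_l`, as the list of the pairs of the weight `κ_l`
and the exponent matrix `d^l` of `ξ_l`. -/
abbrev PolyForm (Q : Type) : Type := List (ℝ × (Q → Q → ℤ))

/-- The polynomial form of an expression, obtained by expanding sums, differences and products
from the leaves upwards. -/
noncomputable def PSE.polyForm {Q : Type} [DecidableEq Q] : PSE Q → PolyForm Q
  | .const κ => [(κ, fun _ _ => 0)]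
  | .mono ξ => [(1, ξ.exponent)]
  | .add φ ψ => φ.polyForm ++ ψ.polyForm
  | .sub φ ψ => φ.polyForm ++ ψ.polyForm.map (fun s => (-s.1, s.2))
  | .mul φ ψ =>
      φ.polyForm.flatMap fun s => ψ.polyForm.map fun t =>
        (s.1 * t.1, fun i j => s.2 i j + t.2 i j)

/-! ### Matrix beta prior and Bayesian posterior -/

/-- Lebesgue measure on the simplex `Δ(n) ⊆ ℝ^{n+1}`, parametrized by all coordinates
but the first one. -/
noncomputable def simplexVolume (n : ℕ) : Measure (Fin (n + 1) → ℝ) :=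
  ((volume : Measure (Fin n → ℝ)).restrict {y | (∀ i, 0 ≤ y i) ∧ ∑ i, y i ≤ 1}).map
    (fun y => (Fin.cons (1 - ∑ i, y i) y : Fin (n + 1) → ℝ))

/-- Lebesgue measure `dM` on `Δ(n)^{n+1}`, the set of stochastic matrices with `n + 1` states. -/
noncomputable def stochVolume (n : ℕ) : Measure (Fin (n + 1) → Fin (n + 1) → ℝ) :=
  Measure.pi fun _ => simplexVolume n

/-- The matrix beta density
`∏_i (Γ(∑_j θ_{ij}) / ∏_j Γ(θ_{ij})) · ∏_{i,j} M_{ij} ^ (θ_{ij} - 1)`,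
for a parameter matrix of positive integers. -/
noncomputable def matrixBetaDensity {n : ℕ} (θ : Fin (n + 1) → Fin (n + 1) → ℕ)
    (M : Fin (n + 1) → Fin (n + 1) → ℝ) : ℝ :=
  (∏ i, (Real.Gamma (∑ j, (θ i j : ℝ)) / ∏ j, Real.Gamma (θ i j : ℝ))) *
    ∏ i, ∏ j, M i j ^ (θ i j - 1)

/-- The prior: the matrix beta distribution with parameter `θ`. -/
noncomputable def matrixBeta {n : ℕ} (θ : Fin (n + 1) → Fin (n + 1) → ℕ) :
    Measure (Fin (n + 1) → Fin (n + 1) → ℝ) :=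
  (stochVolume n).withDensity fun M => ENNReal.ofReal (matrixBetaDensity θ M)

/-- The product of the transition probabilities along a word. -/
noncomputable def transProd {Q : Type} (M : Q → Q → ℝ) : List Q → ℝ
  | a :: b :: w => M a b * transProd M (b :: w)
  | _ => 1

/-- The probability `P(x ∣ M)` that the chain with transition matrix `M` and initial state `q₀`
starts with the word `x`. -/
noncomputable def pathProb {Q : Type} [DecidableEq Q] (q₀ : Q) (M : Q → Q → ℝ) : List Q → ℝ
  | [] => 1
  | a :: w => if a = q₀ then transProd M (a :: w) else 0

/-- The posterior distribution of the transition matrix given the observed word `x`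
by Bayes' rule: its density with respect to the prior `μ` is
`P(x ∣ M) / ∫ P(x ∣ M') dμ(M')`. -/
noncomputable def posterior {n : ℕ} (μ : Measure (Fin (n + 1) → Fin (n + 1) → ℝ))
    (q₀ : Fin (n + 1)) (x : List (Fin (n + 1))) : Measure (Fin (n + 1) → Fin (n + 1) → ℝ) :=
  μ.withDensity fun M =>
    ENNReal.ofReal (pathProb q₀ M x) / ∫⁻ M', ENNReal.ofReal (pathProb q₀ M' x) ∂μ

/-! ### Randomized register monitors -/

/-- Terms over the signature `⟨0, 1, +, -, ×, ÷⟩` with variables in `R`. -/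
inductive Term (R : Type) : Type
  | zero : Term R
  | one : Term R
  | reg (r : R) : Term R
  | add (s t : Term R) : Term R
  | sub (s t : Term R) : Term R
  | mul (s t : Term R) : Term R
  | div (s t : Term R) : Term R

/-- The value of a term under a valuation of the registers (which hold natural numbers:
subtraction is truncated and division rounds down). -/
def Term.eval {R : Type} (v : R → ℕ) : Term R → ℕ
  | .zero => 0
  | .one => 1
  | .reg r => v r
  | .add s t => s.eval v + t.eval v
  | .sub s t => s.eval v - t.eval v
  | .mul s t => s.eval v * t.eval v
  | .div s t => s.eval v / t.eval v

/-- Atomic formulas. -/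
inductive Atom (R : Type) : Type
  | le (s t : Term R) : Atom R
  | eq (s t : Term R) : Atom R

def Atom.Holds {R : Type} (v : R → ℕ) : Atom R → Prop
  | .le s t => s.eval v ≤ t.eval v
  | .eq s t => s.eval v = t.eval v

/-- A test is a conjunction of atomic formulas (marked `true`) and negated atomic formulas
(marked `false`). -/
abbrev Test (R : Type) : Type := List (Bool × Atom R)

def Test.Holds {R : Type} (v : R → ℕ) (τ : Test R) : Prop :=
  ∀ l ∈ τ, (l.1 = true ↔ l.2.Holds v)

/-- An update assigns a term to every register. -/
abbrev Update (R : Type) : Type := R → Term R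

def Update.apply {R : Type} (γ : Update R) (v : R → ℕ) : R → ℕ := fun r => (γ r).eval v

/-- A randomized register monitor with input alphabet `S` and output alphabet `L`. The transition
function is partial; for each input symbol and valuation exactly one test that holds
is in its domain. -/
structure RegisterMonitor (S L : Type) where
  R : Type
  finite : Finite R
  out : (R → ℕ) → L
  trans : S → Test R → Option (PMF (Update R))
  unique : ∀ (s : S) (v : R → ℕ), ∃! τ : Test R, Test.Holds v τ ∧ (trans s τ).isSome = true

namespace RegisterMonitor

variable {S L : Type}

/-- The distribution of the next valuation after reading `s` at the valuation `v`. -/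
noncomputable def step (A : RegisterMonitor S L) (s : S) (v : A.R → ℕ) : PMF (A.R → ℕ) :=
  ((A.trans s (A.unique s v).choose).get (A.unique s v).choose_spec.1.2).map
    fun γ => Update.apply γ v

/-- The distribution of the last valuation of a run on a word. -/
noncomputable def run (A : RegisterMonitor S L) : List S → (A.R → ℕ) → PMF (A.R → ℕ)
  | [], v => PMF.pure v
  | s :: w, v => (A.step s v).bind (run A w)

/-- The semantics `⟦A⟧(w)`: the distribution of the output after reading `w`, all registers being
`0` at the start. -/
noncomputable def semantics (A : RegisterMonitor S L) (w : List S) : PMF L :=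
  (A.run w fun _ => 0).map A.out

end RegisterMonitor

/-! ### The Bayesian monitoring problem -/

/-- The output alphabet: `some (l, u)` is the interval `[l, u]`, and `none` is the symbol `⊥`
(no estimate yet). -/
abbrev Verdict : Type := Option (ℝ × ℝ)

/-- The values that a verdict admits. The symbol `⊥` excludes no value. -/
def Verdict.toSet : Verdict → Set ℝ
  | none => Set.univ
  | some I => Set.Icc I.1 I.2

/-- The probability that `φ(M) ∈ ⟦A⟧(x)` given `x`, where `M` has the posterior distribution for
the prior `μ` and the monitor draws its random updates independently of `M`. -/
noncomputable def coverProb {n : ℕ} (μ : Measure (Fin (n + 1) → Fin (n + 1) → ℝ))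
    (q₀ : Fin (n + 1)) (φ : PSE (Fin (n + 1)))
    (A : RegisterMonitor (Fin (n + 1)) Verdict) (x : List (Fin (n + 1))) : ℝ≥0∞ :=
  ∑' I : Verdict, A.semantics x I * posterior μ q₀ x {M | φ.eval M ∈ I.toSet}

/-- `A` solves the Bayesian monitoring problem for `φ`, `δ`, the prior `μ` on the transition
matrix and the fixed initial state `q₀`. -/
def SolvesBayesianMonitoring {n : ℕ} (μ : Measure (Fin (n + 1) → Fin (n + 1) → ℝ))
    (q₀ : Fin (n + 1)) (φ : PSE (Fin (n + 1))) (δ : ℝ)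
    (A : RegisterMonitor (Fin (n + 1)) Verdict) : Prop :=
  ∀ C : MarkovChain (n + 1), C.StartsAt q₀ → ∀ x : List (Fin (n + 1)), C.IsPath x →
    ENNReal.ofReal (1 - δ) ≤ coverProb μ q₀ φ A x

/-! ### Deterministic monitors given by a decision table -/

/-- The test which says that each atom `at_ k` has the truth value `b k`. -/
noncomputable def tableTest {R ι : Type} [Fintype ι] (at_ : ι → Atom R) (b : ι → Bool) : Test R :=
  (Finset.univ : Finset ι).toList.map fun k => (b k, at_ k)

theorem tableTest_holds {R ι : Type} [Fintype ι] (at_ : ι → Atom R) (b : ι → Bool) (v : R → ℕ) :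
    Test.Holds v (tableTest at_ b) ↔ ∀ k, (b k = true ↔ (at_ k).Holds v) := by
  simp [Test.Holds, tableTest]

open Classical in
/-- The deterministic monitor that evaluates, on the input symbol `s`, finitely many atomic
formulas `at_ s k`, and performs the update `upd s b`, where `b` are their truth values. -/
noncomputable def tableMonitor {S L R ι : Type} [Finite R] [Fintype ι] (out : (R → ℕ) → L)
    (at_ : S → ι → Atom R) (upd : S → (ι → Bool) → Update R) : RegisterMonitor S L where
  R := R
  finite := inferInstance
  out := out
  trans s τ :=
    if h : ∃ b, τ = tableTest (at_ s) b then some (PMF.pure (upd s h.choose)) else none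
  unique s v := by
    refine ⟨tableTest (at_ s) fun k => decide ((at_ s k).Holds v), ⟨?_, ?_⟩, ?_⟩
    · rw [tableTest_holds]
      intro k
      simp
    · rw [dif_pos ⟨_, rfl⟩]
      rfl
    · rintro τ ⟨hv, hs⟩
      by_cases h : ∃ b, τ = tableTest (at_ s) b
      · obtain ⟨b, rfl⟩ := h
        rw [tableTest_holds] at hv
        congr 1
        funext k
        by_cases hk : (at_ s k).Holds v
        · simp [hk, (hv k).2 hk]
        · have hb : ¬ (b k = true) := fun hb => hk ((hv k).1 hb)
          simp [hk, hb]
      · simp [h] at hs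

/-! ### Terms used by the monitors -/

namespace Term

variable {R : Type}

/-- The numeral `k`. -/
def ofNat : ℕ → Term R
  | 0 => zero
  | k + 1 => add (ofNat k) one

/-- `t + z` for an integer constant `z`. -/
def addInt (t : Term R) (z : ℤ) : Term R := sub (add t (ofNat z.toNat)) (ofNat (-z).toNat)

/-- The product of a list of terms. -/
def prod : List (Term R) → Term R
  | [] => one
  | t :: l => mul t (prod l)

/-- The number `t! / (t - k)! = t (t - 1) ⋯ (t - k + 1)` of permutations of `k` items
out of `t`. -/
def perm (t : Term R) (k : ℕ) : Term R := prod ((List.range k).map fun i => sub t (ofNat i))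

/-- Replaces the registers of a term. -/
def rename {R' : Type} (f : R → R') : Term R → Term R'
  | zero => zero
  | one => one
  | reg r => reg (f r)
  | add s t => add (s.rename f) (t.rename f)
  | sub s t => sub (s.rename f) (t.rename f)
  | mul s t => mul (s.rename f) (t.rename f)
  | div s t => div (s.rename f) (t.rename f)

end Term

def Atom.rename {R R' : Type} (f : R → R') : Atom R → Atom R'
  | .le s t => .le (s.rename f) (t.rename f)
  | .eq s t => .eq (s.rename f) (t.rename f)

/-! ### `BayesExpMonitor`

The parameters are the exponent matrices `d^l`, `l = 1, …, p`, of a polynomial form, and `θ`. -/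

/-- The registers of `BayesExpMonitor`. `prev` holds `0` before the first symbol, and then the
number `σ + 1` of the previous state `σ : Fin (n + 1)`; `cnt i j` and `row i` are the counters
`c̄_{ij}` and `c̄_i`; `active` is `0` or `1`; and `h^l` is kept as the fraction `num l / den l`. -/
inductive ExpReg (n p : ℕ) : Type
  | prev : ExpReg n p
  | cnt (i j : Fin (n + 1)) : ExpReg n p
  | row (i : Fin (n + 1)) : ExpReg n p
  | active : ExpReg n p
  | num (l : Fin p) : ExpReg n p
  | den (l : Fin p) : ExpReg n p
  deriving Fintype

/-- The names of the conditions that `BayesExpMonitor` evaluates: the previous state is `q`;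
`active = 1`; the consistency condition for `v_{ij}` after the increment of the counters,
when the previous state is `q`. -/
inductive ExpCond (n : ℕ) : Type
  | prevIs (q : Fin (n + 1)) : ExpCond n
  | isActive : ExpCond n
  | consistent (q i j : Fin (n + 1)) : ExpCond n
  deriving Fintype

namespace ExpMonitor

variable {n p : ℕ}

/-- `d_i = ∑_j d_{ij}` -/
def rowExp (d : Fin (n + 1) → Fin (n + 1) → ℤ) (i : Fin (n + 1)) : ℤ := ∑ j, d i j

/-- `m_{ij} = min_l d_{ij}^l` -/
noncomputable def minExp (d : Fin p → Fin (n + 1) → Fin (n + 1) → ℤ) (i j : Fin (n + 1)) : ℤ :=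
  ⨅ l, d l i j

/-- The counter `c̄_{ij}` after the increment for the step from `q` to `s`. -/
def cntNext (q s i j : Fin (n + 1)) : Term (ExpReg n p) :=
  if i = q ∧ j = s then .add (.reg (.cnt i j)) .one else .reg (.cnt i j)

/-- The counter `c̄_i` after the increment for a step from `q`. -/
def rowNext (q i : Fin (n + 1)) : Term (ExpReg n p) :=
  if i = q then .add (.reg (.row i)) .one else .reg (.row i)

/-- The numerator of `H`, for counters given by the terms `c` and `r`:
`∏_i ∏_{d_{ij} > 0} P(c̄_{ij} - 1 + |d_{ij}|, |d_{ij}|) · ∏_{d_i < 0} P(c̄_i - 1, |d_i|)`. -/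
def numH {R : Type} (d : Fin (n + 1) → Fin (n + 1) → ℤ)
    (c : Fin (n + 1) → Fin (n + 1) → Term R) (r : Fin (n + 1) → Term R) : Term R :=
  .mul
    (.prod ((List.finRange (n + 1)).map fun i =>
      .prod (((List.finRange (n + 1)).filter fun j => 0 < d i j).map fun j =>
        .perm (.add (.sub (c i j) .one) (.ofNat (d i j).natAbs)) (d i j).natAbs)))
    (.prod (((List.finRange (n + 1)).filter fun i => rowExp d i < 0).map fun i =>
      .perm (.sub (r i) .one) (rowExp d i).natAbs))

/-- The denominator of `H`:
`∏_{d_i > 0} P(c̄_i - 1 + |d_i|, |d_i|) · ∏_i ∏_{d_{ij} < 0} P(c̄_{ij} - 1, |d_{ij}|)`. -/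
def denH {R : Type} (d : Fin (n + 1) → Fin (n + 1) → ℤ)
    (c : Fin (n + 1) → Fin (n + 1) → Term R) (r : Fin (n + 1) → Term R) : Term R :=
  .mul
    (.prod (((List.finRange (n + 1)).filter fun i => 0 < rowExp d i).map fun i =>
      .perm (.add (.sub (r i) .one) (.ofNat (rowExp d i).natAbs)) (rowExp d i).natAbs))
    (.prod ((List.finRange (n + 1)).map fun i =>
      .prod (((List.finRange (n + 1)).filter fun j => d i j < 0).map fun j =>
        .perm (.sub (c i j) .one) (d i j).natAbs)))

/-- `Init(s)` -/
def initUpdate (θ : Fin (n + 1) → Fin (n + 1) → ℕ) (s : Fin (n + 1)) : Update (ExpReg n p)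
  | .prev => .ofNat (s.val + 1)
  | .cnt i j => .ofNat (θ i j)
  | .row i => .ofNat (∑ j, θ i j)
  | .active => .zero
  | .num _ => .zero
  | .den _ => .zero

/-- `Next(s)` when the previous state is `q`. The truth value of `active` before the call is
`act`, and that of the consistency condition after the increment of the counters is `ok`. -/
def nextUpdate (d : Fin p → Fin (n + 1) → Fin (n + 1) → ℤ) (q s : Fin (n + 1)) (act ok : Bool) :
    Update (ExpReg n p)
  | .prev => .ofNat (s.val + 1)
  | .cnt i j => cntNext q s i j
  | .row i => rowNext q i
  | .active => if act || ok then .one else .zero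
  | .num l =>
      if act then
        .mul (.reg (.num l))
          (.mul (.addInt (.sub (cntNext q s q s) .one) (d l q s)) (.sub (rowNext q q) .one))
      else if ok then numH (d l) (cntNext q s) (rowNext q)
      else .reg (.num l)
  | .den l =>
      if act then
        .mul (.reg (.den l))
          (.mul (.sub (cntNext q s q s) .one)
            (.addInt (.sub (rowNext q q) .one) (rowExp (d l) q)))
      else if ok then denH (d l) (cntNext q s) (rowNext q)
      else .reg (.den l)

/-- The conditions as atomic formulas, on the input symbol `s`; the consistency condition
`c̄_{ij} + m_{ij} > 0` is `1 ≤ c̄_{ij} + m_{ij}`. -/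
noncomputable def atoms (d : Fin p → Fin (n + 1) → Fin (n + 1) → ℤ) (s : Fin (n + 1)) :
    ExpCond n → Atom (ExpReg n p)
  | .prevIs q => .eq (.reg .prev) (.ofNat (q.val + 1))
  | .isActive => .eq (.reg .active) .one
  | .consistent q i j => .le .one (.addInt (cntNext q s i j) (minExp d i j))

open Classical in
/-- One call: `Init` on the first symbol, and `Next` afterwards. The consistency condition
ranges over the variables that occur in the polynomial form. -/
noncomputable def update (θ : Fin (n + 1) → Fin (n + 1) → ℕ)
    (d : Fin p → Fin (n + 1) → Fin (n + 1) → ℤ) (s : Fin (n + 1)) (b : ExpCond n → Bool) :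
    Update (ExpReg n p) :=
  if h : ∃ q, b (.prevIs q) = true then
    nextUpdate d h.choose s (b .isActive)
      (decide (∀ i j, (∃ l, d l i j ≠ 0) → b (.consistent h.choose i j) = true))
  else initUpdate θ s

/-- The value `E` of the monitor for the polynomial form `P`: `⊥` unless it is active, and then
`∑_l κ_l h^l`. -/
noncomputable def value (P : PolyForm (Fin (n + 1))) (v : ExpReg n P.length → ℕ) : Option ℝ :=
  if v .active = 1 then
    some (∑ l : Fin P.length, (P.get l).1 * ((v (.num l) : ℝ) / (v (.den l) : ℝ)))
  else none

end ExpMonitor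

/-! ### `BayesConfIntMonitor` -/

/-- The verdict `[E ± √((E₂ - E²) / δ)]`, or `⊥` if `E` or `E₂` is `⊥`. -/
noncomputable def confInt (δ : ℝ) : Option ℝ → Option ℝ → Verdict
  | some E, some E₂ => some (E - √((E₂ - E ^ 2) / δ), E + √((E₂ - E ^ 2) / δ))
  | _, _ => none

/-- `BayesConfIntMonitor`: it runs in parallel `BayesExpMonitor` for the polynomial forms of `φ`
(on the left registers) and of `φ² = φ · φ` (on the right registers). -/
noncomputable def bayesConfIntMonitor {n : ℕ} (φ : PSE (Fin (n + 1)))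
    (θ : Fin (n + 1) → Fin (n + 1) → ℕ) (δ : ℝ) : RegisterMonitor (Fin (n + 1)) Verdict :=
  let P : PolyForm (Fin (n + 1)) := φ.polyForm
  let P₂ : PolyForm (Fin (n + 1)) := (φ.mul φ).polyForm
  let d : Fin P.length → Fin (n + 1) → Fin (n + 1) → ℤ := fun l => (P.get l).2
  let d₂ : Fin P₂.length → Fin (n + 1) → Fin (n + 1) → ℤ := fun l => (P₂.get l).2
  tableMonitor (R := ExpReg n P.length ⊕ ExpReg n P₂.length) (ι := ExpCond n ⊕ ExpCond n)
    (fun v => confInt δ (ExpMonitor.value P (v ∘ Sum.inl)) (ExpMonitor.value P₂ (v ∘ Sum.inr)))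
    (fun s => Sum.elim (fun k => (ExpMonitor.atoms d s k).rename Sum.inl)
      (fun k => (ExpMonitor.atoms d₂ s k).rename Sum.inr))
    (fun s b => Sum.elim (fun r => (ExpMonitor.update θ d s (b ∘ Sum.inl) r).rename Sum.inl)
      (fun r => (ExpMonitor.update θ d₂ s (b ∘ Sum.inr) r).rename Sum.inr))

/-! ### The consistency condition -/

/-- The number `c_{ij}(x)` of occurrences of `ij` in the word `x`. -/
def edgeCount {Q : Type} [DecidableEq Q] (i j : Q) : List Q → ℕ
  | a :: b :: w => (if a = i ∧ b = j then 1 else 0) + edgeCount i j (b :: w)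
  | _ => 0

/-- `c_{ij}(x) + θ_{ij} + d_{ij}^l > 0` for every `i`, `j` and every summand `l`. -/
def Consistent {Q : Type} [DecidableEq Q] (θ : Q → Q → ℕ) (P : PolyForm Q) (x : List Q) : Prop :=
  ∀ t ∈ P, ∀ i j, 0 < (edgeCount i j x : ℤ) + θ i j + t.2 i j

/-- At least one transition has been observed, and the consistency condition holds for the
polynomial forms of `φ` and `φ²`. -/
def Ready {Q : Type} [DecidableEq Q] (θ : Q → Q → ℕ) (φ : PSE Q) (x : List Q) : Prop :=
  2 ≤ x.length ∧ Consistent θ φ.polyForm x ∧ Consistent θ (φ.mul φ).polyForm x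

end BayesMonitor

/-! The matrix beta prior is conjugate to Markov chain observations: the likelihood of a word is the
monomial whose exponents are its transition counts, so multiplying by it and renormalizing only adds
the counts to `θ` (`posterior_eq`). Everything about the posterior therefore reduces to moments of a
matrix beta distribution with parameter `c = θ + edgeCount`.

These moments are explicit. The density times a monomial with exponents `d` is, when `c + d > 0`,
again an unnormalized matrix beta density, so the moment is a ratio of two normalizing constants
(`integral_monomialVal`), each a product over rows of Dirichlet integrals
(`lintegral_dirichletFun`). Expressions agree almost everywhere with their polynomial forms, so
linearity gives the moments of `φ` and `φ²`.

The moments are ratios of Gamma values at arguments differing by integers, hence quotients of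
falling factorials (`betaMoment_eq`), and incrementing one counter multiplies them by a rational
factor because `Γ(x + 1) = x Γ(x)` (`betaMoment_increment`). This is what the registers compute,
exactly and in natural numbers. `Invariant` carries it along the word; it survives because counters
only grow, so consistency, once reached, is never lost and no subtraction is truncated.

Thus the two parallel monitors hold the posterior means of `φ` and `φ²`, the output is the mean plus
or minus `√(V / δ)`, and Chebyshev's inequality (`one_sub_le_measure_Icc`) gives the coverage. When
the output is `⊥`, coverage is trivial. -/

namespace BayesMonitor

/-! ### The Dirichlet integral -/

section Dirichlet

open Nat

/-- Euler's beta integral over `[0, s]` for natural exponents. -/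
theorem integral_pow_mul_sub_pow (a b : ℕ) {s : ℝ} (hs : 0 ≤ s) :
    ∫ t in (0 : ℝ)..s, t ^ a * (s - t) ^ b =
      s ^ (a + b + 1) * ((a ! * b ! : ℝ) / (a + b + 1)!) := by
  rcases hs.eq_or_lt with rfl | hs
  · simp
  have h := Complex.betaIntegral_scaled (a + 1) (b + 1) hs
  rw [Complex.betaIntegral_eq_Gamma_mul_div _ _ (by simp; positivity) (by simp; positivity)] at h
  have e : ((a : ℂ) + 1 + (b + 1)) = ((a + b + 1 : ℕ) : ℂ) + 1 := by push_cast; ring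
  rw [e, Complex.Gamma_nat_eq_factorial, Complex.Gamma_nat_eq_factorial,
    Complex.Gamma_nat_eq_factorial] at h
  simp only [add_sub_cancel_right, Complex.cpow_natCast] at h
  rw [← Complex.ofReal_inj, ← intervalIntegral.integral_ofReal]
  push_cast at h ⊢
  exact h

/-- The integrand of the Dirichlet integral over the simplex of size `s`. -/
noncomputable def dirichletFun {n : ℕ} (b : ℕ) (a : Fin n → ℕ) (s : ℝ) (y : Fin n → ℝ) : ℝ≥0∞ :=
  {y : Fin n → ℝ | (∀ i, 0 ≤ y i) ∧ ∑ i, y i ≤ s}.indicator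
    (fun y => ENNReal.ofReal ((s - ∑ i, y i) ^ b * ∏ i, y i ^ a i)) y

theorem measurableSet_subsimplex (n : ℕ) (s : ℝ) :
    MeasurableSet {y : Fin n → ℝ | (∀ i, 0 ≤ y i) ∧ ∑ i, y i ≤ s} := by
  measurability

theorem measurable_dirichletFun {n : ℕ} (b : ℕ) (a : Fin n → ℕ) (s : ℝ) :
    Measurable (dirichletFun b a s) := by
  refine Measurable.indicator ?_ (measurableSet_subsimplex n s)
  fun_prop

/-- Fixing the first free coordinate at `t` leaves a simplex of size `s - t` in the others. This
slicing is why the integrand is defined for every size `s`, not only for `s = 1`. -/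
theorem dirichletFun_cons {n : ℕ} (b : ℕ) (a : Fin (n + 1) → ℕ) (s t : ℝ) (z : Fin n → ℝ) :
    dirichletFun b a s (Fin.cons t z) =
      (Set.Icc 0 s).indicator (fun t => ENNReal.ofReal (t ^ a 0)) t *
        dirichletFun b (fun i => a i.succ) (s - t) z := by
  have hmem : (Fin.cons t z : Fin (n + 1) → ℝ) ∈
      {y : Fin (n + 1) → ℝ | (∀ i, 0 ≤ y i) ∧ ∑ i, y i ≤ s} ↔
      t ∈ Set.Icc 0 s ∧ z ∈ {y : Fin n → ℝ | (∀ i, 0 ≤ y i) ∧ ∑ i, y i ≤ s - t} := by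
    simp only [Set.mem_ofPred_eq, Fin.sum_univ_succ, Fin.cons_zero, Fin.cons_succ,
      Fin.forall_fin_succ, Set.mem_Icc]
    constructor
    · rintro ⟨⟨h0, h1⟩, h2⟩
      have := Finset.sum_nonneg fun i (_ : i ∈ Finset.univ) => h1 i
      exact ⟨⟨h0, by linarith⟩, h1, by linarith⟩
    · rintro ⟨⟨h0, -⟩, h1, h2⟩
      exact ⟨⟨h0, h1⟩, by linarith⟩
  unfold dirichletFun
  by_cases ht : t ∈ Set.Icc 0 s
  · by_cases hz : z ∈ {y : Fin n → ℝ | (∀ i, 0 ≤ y i) ∧ ∑ i, y i ≤ s - t}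
    · rw [Set.indicator_of_mem (hmem.2 ⟨ht, hz⟩), Set.indicator_of_mem hz,
        Set.indicator_of_mem ht, ← ENNReal.ofReal_mul (pow_nonneg ht.1 _)]
      congr 1
      simp only [Fin.sum_univ_succ, Fin.prod_univ_succ, Fin.cons_zero, Fin.cons_succ]
      ring
    · rw [Set.indicator_of_notMem (fun h => hz (hmem.1 h).2), Set.indicator_of_notMem hz,
        mul_zero]
  · rw [Set.indicator_of_notMem (fun h => ht (hmem.1 h).1), Set.indicator_of_notMem ht, zero_mul]

theorem lintegral_Icc_pow_mul_sub_pow (a b : ℕ) {s : ℝ} (hs : 0 ≤ s) {C : ℝ} (hC : 0 ≤ C) :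
    ∫⁻ t in Set.Icc 0 s, ENNReal.ofReal (t ^ a) * ENNReal.ofReal ((s - t) ^ b * C) =
      ENNReal.ofReal (s ^ (a + b + 1) * ((a ! * b ! : ℝ) / (a + b + 1)!) * C) := by
  have hc : Continuous fun t : ℝ => t ^ a * (s - t) ^ b * C := by fun_prop
  rw [← integral_pow_mul_sub_pow a b hs, intervalIntegral.integral_of_le hs,
    ← integral_Icc_eq_integral_Ioc, ← integral_mul_const, ofReal_integral_eq_lintegral_ofReal]
  · refine setLIntegral_congr_fun measurableSet_Icc fun t ht => ?_
    rw [← ENNReal.ofReal_mul (pow_nonneg ht.1 _), mul_assoc]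
  · exact hc.integrableOn_Icc
  · refine (ae_restrict_iff' measurableSet_Icc).2 (.of_forall fun t ht => ?_)
    have h1 : 0 ≤ t := ht.1
    have h2 : 0 ≤ s - t := sub_nonneg.2 ht.2
    simp only [Pi.zero_apply]
    positivity

/-- By Fubini and induction on the dimension: the inner integral over the simplex of size `s - t` is
a constant times a power of `s - t`, and what remains is a one-dimensional beta integral. The
factorial in the inner denominator cancels against the one that the beta integral produces. -/
theorem lintegral_dirichletFun {n : ℕ} (b : ℕ) (a : Fin n → ℕ) {s : ℝ} (hs : 0 ≤ s) :
    ∫⁻ y, dirichletFun b a s y =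
      ENNReal.ofReal (s ^ (b + ∑ i, a i + n) *
        ((b ! * ∏ i, ((a i)! : ℝ)) / (b + ∑ i, a i + n)!)) := by
  induction n generalizing s with
  | zero =>
    rw [lintegral_unique]
    have : (b ! : ℝ) ≠ 0 := by positivity
    simp [dirichletFun, hs, volume_pi, this]
  | succ n ih =>
    let e := MeasurableEquiv.piFinSuccAbove (fun _ : Fin (n + 1) => ℝ) 0
    have he : ∀ t z, e.symm (t, z) = Fin.cons t z := fun t z => by
      simp [e, MeasurableEquiv.piFinSuccAbove, Fin.consEquiv]
    have hm : Measurable fun p => dirichletFun b a s (e.symm p) :=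
      (measurable_dirichletFun b a s).comp e.symm.measurable
    rw [← ((volume_preserving_piFinSuccAbove (fun _ : Fin (n + 1) => ℝ) 0).symm
      e).lintegral_comp (measurable_dirichletFun b a s),
      Measure.volume_eq_prod, lintegral_prod _ hm.aemeasurable]
    have key : ∀ t : ℝ, ∫⁻ z : Fin n → ℝ, dirichletFun b a s (e.symm (t, z)) =
        (Set.Icc 0 s).indicator (fun t => ENNReal.ofReal (t ^ a 0) *
          ENNReal.ofReal ((s - t) ^ (b + ∑ i : Fin n, a i.succ + n) *
            ((b ! * ∏ i : Fin n, ((a i.succ)! : ℝ)) /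
              (b + ∑ i : Fin n, a i.succ + n)!))) t := by
      intro t
      simp only [he, dirichletFun_cons b a s t]
      rw [lintegral_const_mul _ (measurable_dirichletFun _ _ _)]
      by_cases hts : t ∈ Set.Icc 0 s
      · rw [Set.indicator_of_mem hts, Set.indicator_of_mem hts, ih _ (sub_nonneg.2 hts.2)]
      · rw [Set.indicator_of_notMem hts, Set.indicator_of_notMem hts, zero_mul]
    rw [lintegral_congr key, lintegral_indicator measurableSet_Icc,
      lintegral_Icc_pow_mul_sub_pow _ _ hs (by positivity)]
    have e : a 0 + (b + ∑ i : Fin n, a i.succ + n) + 1 = b + ∑ i, a i + (n + 1) := by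
      rw [Fin.sum_univ_succ]; ring
    rw [e, Fin.prod_univ_succ]
    congr 1
    field_simp

end Dirichlet

/-! ### Moments of the matrix beta distribution -/

section Moments

variable {n : ℕ}

theorem measurable_simplexParam :
    Measurable fun y : Fin n → ℝ => (Fin.cons (1 - ∑ i, y i) y : Fin (n + 1) → ℝ) := by
  refine measurable_pi_lambda _ fun i => ?_
  refine Fin.cases ?_ (fun j => ?_) i
  · simp only [Fin.cons_zero]; fun_prop
  · simp only [Fin.cons_succ]; fun_prop

open Nat in
/-- The Dirichlet integral over the simplex. -/
theorem lintegral_simplexVolume (k : Fin (n + 1) → ℕ) :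
    ∫⁻ y, ENNReal.ofReal (∏ j, y j ^ k j) ∂simplexVolume n =
      ENNReal.ofReal ((∏ j, ((k j)! : ℝ)) / (∑ j, k j + n)!) := by
  rw [simplexVolume, lintegral_map (by fun_prop) measurable_simplexParam,
    ← lintegral_indicator (measurableSet_subsimplex n 1)]
  have h := lintegral_dirichletFun (k 0) (fun i : Fin n => k i.succ) zero_le_one
  simp only [one_pow, one_mul, ← Fin.sum_univ_succ, ← Fin.prod_univ_succ (fun j => ((k j)! : ℝ))]
    at h
  rw [← h]
  refine lintegral_congr fun y => ?_
  simp only [dirichletFun, Fin.prod_univ_succ, Fin.cons_zero, Fin.cons_succ]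

instance isFiniteMeasure_simplexVolume : IsFiniteMeasure (simplexVolume n) := by
  constructor
  have h := lintegral_simplexVolume (n := n) 0
  simp only [Pi.zero_apply, pow_zero, Finset.prod_const_one, ENNReal.ofReal_one,
    lintegral_one] at h
  rw [h]
  exact ENNReal.ofReal_lt_top

/-- The set is an affine subspace that misses the origin, hence proper, hence null. It is the face
where the dependent coordinate vanishes. -/
theorem volume_sum_eq_one : (volume : Measure (Fin n → ℝ)) {y | ∑ i, y i = 1} = 0 := by
  let A : AffineSubspace ℝ (Fin n → ℝ) :=
    { carrier := {y | ∑ i, y i = 1}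
      smul_vsub_vadd_mem' := by
        intro c p q r hp hq hr
        simp only [Set.mem_ofPred_eq, vsub_eq_sub, vadd_eq_add, Pi.add_apply, Pi.smul_apply,
          Pi.sub_apply, smul_eq_mul, Finset.sum_add_distrib, ← Finset.mul_sum,
          Finset.sum_sub_distrib] at hp hq hr ⊢
        rw [hp, hq, hr]; ring }
  refine Measure.addHaar_affineSubspace volume A fun h => ?_
  have h0 : (0 : Fin n → ℝ) ∈ A := h ▸ AffineSubspace.mem_top _ _ _
  have h1 : ∑ i : Fin n, (0 : Fin n → ℝ) i = 1 := h0
  simp at h1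

theorem ae_pos_simplexVolume : ∀ᵐ y ∂simplexVolume n, ∀ j, 0 < y j := by
  rw [simplexVolume, ae_map_iff measurable_simplexParam.aemeasurable (by measurability),
    ae_restrict_iff' (measurableSet_subsimplex n 1)]
  have h1 : ∀ᵐ y : Fin n → ℝ, ∑ i, y i ≠ 1 := by
    simpa [ae_iff] using volume_sum_eq_one (n := n)
  have h2 : ∀ᵐ y : Fin n → ℝ, ∀ i, y i ≠ 0 :=
    ae_all_iff.2 fun i => Measure.ae_eval_ne (fun _ : Fin n => (volume : Measure ℝ)) i 0
  filter_upwards [h1, h2] with y hy1 hy2 hy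
  refine Fin.cases ?_ (fun j => ?_)
  · simp only [Fin.cons_zero, sub_pos]
    exact lt_of_le_of_ne hy.2 hy1
  · simp only [Fin.cons_succ]
    exact lt_of_le_of_ne (hy.1 j) (hy2 j).symm

/-- Zero entries are negligible, so the conventions `1 / 0 = 0` and `0 ^ 0 = 1` never affect an
integral and integer exponents can be added freely. -/
theorem ae_pos_stochVolume : ∀ᵐ M ∂stochVolume n, ∀ i j, 0 < M i j := by
  rw [ae_all_iff]
  intro i
  exact (Measure.quasiMeasurePreserving_eval (μ := fun _ => simplexVolume n) i).ae
    ae_pos_simplexVolume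

theorem integrable_simplexVolume (k : Fin (n + 1) → ℕ) :
    Integrable (fun y : Fin (n + 1) → ℝ => ∏ j, y j ^ k j) (simplexVolume n) := by
  have h0 : 0 ≤ᵐ[simplexVolume n] fun y : Fin (n + 1) → ℝ => ∏ j, y j ^ k j := by
    filter_upwards [ae_pos_simplexVolume] with y hy
    exact Finset.prod_nonneg fun j _ => pow_nonneg (hy j).le _
  refine ⟨(by fun_prop : Measurable _).aestronglyMeasurable, ?_⟩
  rw [hasFiniteIntegral_iff_ofReal h0, lintegral_simplexVolume]
  exact ENNReal.ofReal_lt_top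

open Nat in
theorem integral_simplexVolume (k : Fin (n + 1) → ℕ) :
    ∫ y, ∏ j, y j ^ k j ∂simplexVolume n = (∏ j, ((k j)! : ℝ)) / (∑ j, k j + n)! := by
  rw [integral_eq_lintegral_of_nonneg_ae, lintegral_simplexVolume, ENNReal.toReal_ofReal]
  · positivity
  · filter_upwards [ae_pos_simplexVolume] with y hy
    exact Finset.prod_nonneg fun j _ => pow_nonneg (hy j).le _
  · exact (by fun_prop : Measurable _).aestronglyMeasurable

/-- The normalizing constant `∏_i (∏_j Γ(c_{ij}) / Γ(∑_j c_{ij}))` of the matrix beta density. -/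
noncomputable def matrixBetaConst (c : Fin (n + 1) → Fin (n + 1) → ℝ) : ℝ :=
  ∏ i, ((∏ j, Real.Gamma (c i j)) / Real.Gamma (∑ j, c i j))

theorem matrixBetaConst_pos {c : Fin (n + 1) → Fin (n + 1) → ℝ} (hc : ∀ i j, 0 < c i j) :
    0 < matrixBetaConst c := by
  refine Finset.prod_pos fun i _ => div_pos (Finset.prod_pos fun j _ => Real.Gamma_pos_of_pos
    (hc i j)) (Real.Gamma_pos_of_pos (Finset.sum_pos (fun j _ => hc i j) Finset.univ_nonempty))

theorem integrable_stochVolume (k : Fin (n + 1) → Fin (n + 1) → ℕ) :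
    Integrable (fun M : Fin (n + 1) → Fin (n + 1) → ℝ => ∏ i, ∏ j, M i j ^ k i j)
      (stochVolume n) :=
  Integrable.fintype_prod fun i => integrable_simplexVolume (k i)

theorem integral_stochVolume (k : Fin (n + 1) → Fin (n + 1) → ℕ) :
    ∫ M, ∏ i, ∏ j, M i j ^ k i j ∂stochVolume n = matrixBetaConst fun i j => (k i j : ℝ) + 1 := by
  rw [stochVolume, integral_fintype_prod_eq_prod (fun i (y : Fin (n + 1) → ℝ) => ∏ j, y j ^ k i j)]
  refine Finset.prod_congr rfl fun i _ => ?_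
  rw [integral_simplexVolume]
  congr 1
  · exact Finset.prod_congr rfl fun j _ => (Real.Gamma_nat_eq_factorial _).symm
  · rw [← Real.Gamma_nat_eq_factorial]
    congr 1
    simp only [Finset.sum_add_distrib]
    simp
    ring

theorem matrixBetaDensity_eq (c : Fin (n + 1) → Fin (n + 1) → ℕ)
    (M : Fin (n + 1) → Fin (n + 1) → ℝ) :
    matrixBetaDensity c M =
      (matrixBetaConst fun i j => (c i j : ℝ))⁻¹ * ∏ i, ∏ j, M i j ^ (c i j - 1) := by
  simp only [matrixBetaDensity, matrixBetaConst, ← Finset.prod_inv_distrib, inv_div]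

theorem measurable_matrixBetaDensity (c : Fin (n + 1) → Fin (n + 1) → ℕ) :
    Measurable (matrixBetaDensity c) := by
  unfold matrixBetaDensity
  fun_prop

theorem matrixBetaDensity_nonneg {c : Fin (n + 1) → Fin (n + 1) → ℕ} (hc : ∀ i j, 1 ≤ c i j)
    {M : Fin (n + 1) → Fin (n + 1) → ℝ} (hM : ∀ i j, 0 < M i j) : 0 ≤ matrixBetaDensity c M := by
  rw [matrixBetaDensity_eq]
  refine mul_nonneg (inv_nonneg.2 (matrixBetaConst_pos fun i j => ?_).le)
    (Finset.prod_nonneg fun i _ => Finset.prod_nonneg fun j _ => pow_nonneg (hM i j).le _)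
  exact_mod_cast hc i j

/-- The monomial `∏_{i,j} M_{ij} ^ d_{ij}` with integer exponents. -/
noncomputable def monomialVal (d : Fin (n + 1) → Fin (n + 1) → ℤ)
    (M : Fin (n + 1) → Fin (n + 1) → ℝ) : ℝ :=
  ∏ i, ∏ j, M i j ^ d i j

theorem measurable_monomialVal (d : Fin (n + 1) → Fin (n + 1) → ℤ) :
    Measurable (monomialVal d) := by
  unfold monomialVal
  refine Finset.measurable_prod _ fun i _ => Finset.measurable_prod _ fun j _ => ?_
  rcases h : d i j with k | k
  · simp only [Int.ofNat_eq_natCast, zpow_natCast]; fun_prop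
  · simp only [zpow_negSucc]; fun_prop

/-- Since `c + d ≥ 1`, the combined exponent `c + d - 1` is a natural number even where `d` is
negative: the poles of the monomial are absorbed by the density, and a polynomial is left to
integrate. -/
theorem matrixBetaDensity_mul_monomialVal {c : Fin (n + 1) → Fin (n + 1) → ℕ}
    {d : Fin (n + 1) → Fin (n + 1) → ℤ} (hc : ∀ i j, 1 ≤ c i j) (hd : ∀ i j, 0 < (c i j : ℤ) + d i j)
    {M : Fin (n + 1) → Fin (n + 1) → ℝ} (hM : ∀ i j, 0 < M i j) :
    matrixBetaDensity c M * monomialVal d M =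
      (matrixBetaConst fun i j => (c i j : ℝ))⁻¹ *
        ∏ i, ∏ j, M i j ^ ((c i j : ℤ) + d i j - 1).toNat := by
  rw [matrixBetaDensity_eq, mul_assoc, monomialVal]
  congr 1
  simp only [← Finset.prod_mul_distrib]
  refine Finset.prod_congr rfl fun i _ => Finset.prod_congr rfl fun j _ => ?_
  rw [← zpow_natCast, ← zpow_natCast, ← zpow_add₀ (hM i j).ne']
  congr 1
  have := hc i j
  have := hd i j
  omega

theorem matrixBetaConst_toNat {c : Fin (n + 1) → Fin (n + 1) → ℕ}
    {d : Fin (n + 1) → Fin (n + 1) → ℤ} (hd : ∀ i j, 0 < (c i j : ℤ) + d i j) :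
    (matrixBetaConst fun i j => ((((c i j : ℤ) + d i j - 1).toNat : ℕ) : ℝ) + 1) =
      matrixBetaConst fun i j => (c i j : ℝ) + d i j := by
  congr 1
  funext i j
  have h : ((((c i j : ℤ) + d i j - 1).toNat : ℕ) : ℤ) = (c i j : ℤ) + d i j - 1 :=
    Int.toNat_of_nonneg (by have := hd i j; omega)
  have h' : ((((c i j : ℤ) + d i j - 1).toNat : ℕ) : ℝ) = (c i j : ℝ) + d i j - 1 := by
    exact_mod_cast congrArg (Int.cast : ℤ → ℝ) h
  rw [h']; ring

theorem ae_pos_matrixBeta (c : Fin (n + 1) → Fin (n + 1) → ℕ) :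
    ∀ᵐ M ∂matrixBeta c, ∀ i j, 0 < M i j :=
  (withDensity_absolutelyContinuous _ _).ae_le ae_pos_stochVolume

theorem integrable_monomialVal {c : Fin (n + 1) → Fin (n + 1) → ℕ}
    {d : Fin (n + 1) → Fin (n + 1) → ℤ} (hc : ∀ i j, 1 ≤ c i j)
    (hd : ∀ i j, 0 < (c i j : ℤ) + d i j) : Integrable (monomialVal d) (matrixBeta c) := by
  rw [matrixBeta, integrable_withDensity_iff_integrable_smul'
    (measurable_matrixBetaDensity c).ennreal_ofReal (by simp)]
  refine ((integrable_stochVolume fun i j => ((c i j : ℤ) + d i j - 1).toNat).const_mul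
    (matrixBetaConst fun i j => (c i j : ℝ))⁻¹).congr ?_
  filter_upwards [ae_pos_stochVolume] with M hM
  rw [ENNReal.toReal_ofReal (matrixBetaDensity_nonneg hc hM), smul_eq_mul,
    matrixBetaDensity_mul_monomialVal hc hd hM]

/-- The moments of the matrix beta distribution. -/
theorem integral_monomialVal {c : Fin (n + 1) → Fin (n + 1) → ℕ}
    {d : Fin (n + 1) → Fin (n + 1) → ℤ} (hc : ∀ i j, 1 ≤ c i j)
    (hd : ∀ i j, 0 < (c i j : ℤ) + d i j) :
    ∫ M, monomialVal d M ∂matrixBeta c =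
      (matrixBetaConst fun i j => (c i j : ℝ) + d i j) / matrixBetaConst fun i j => (c i j : ℝ) := by
  rw [matrixBeta, integral_withDensity_eq_integral_toReal_smul
    (measurable_matrixBetaDensity c).ennreal_ofReal (by simp)]
  rw [← matrixBetaConst_toNat hd, ← integral_stochVolume, div_eq_inv_mul, ← integral_const_mul]
  refine integral_congr_ae ?_
  filter_upwards [ae_pos_stochVolume] with M hM
  rw [ENNReal.toReal_ofReal (matrixBetaDensity_nonneg hc hM), smul_eq_mul,
    matrixBetaDensity_mul_monomialVal hc hd hM]

theorem isProbabilityMeasure_matrixBeta {c : Fin (n + 1) → Fin (n + 1) → ℕ}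
    (hc : ∀ i j, 1 ≤ c i j) : IsProbabilityMeasure (matrixBeta c) := by
  have hd : ∀ i j, 0 < (c i j : ℤ) + (0 : Fin (n + 1) → Fin (n + 1) → ℤ) i j := fun i j => by
    have := hc i j
    simp only [Pi.zero_apply]; omega
  have h1 := integral_monomialVal hc hd
  have hpos : 0 < matrixBetaConst fun i j => (c i j : ℝ) :=
    matrixBetaConst_pos fun i j => by exact_mod_cast hc i j
  simp only [monomialVal, Pi.zero_apply, zpow_zero, Finset.prod_const_one, Int.cast_zero, add_zero,
    div_self hpos.ne', integral_const, smul_eq_mul, mul_one] at h1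
  constructor
  -- The moment with `d = 0` gives total mass one only after `toReal`; the value being 1 also
  -- excludes infinite mass.
  rwa [measureReal_def, ENNReal.toReal_eq_one_iff] at h1

/-! ### The posterior -/

theorem transProd_eq (M : Fin (n + 1) → Fin (n + 1) → ℝ) (x : List (Fin (n + 1))) :
    transProd M x = monomialVal (fun i j => (edgeCount i j x : ℤ)) M := by
  induction x with
  | nil => simp [transProd, monomialVal, edgeCount]
  | cons a w ih =>
    cases w with
    | nil => simp [transProd, monomialVal, edgeCount]
    | cons b w =>
      rw [transProd, ih]
      simp only [monomialVal, edgeCount, zpow_natCast, pow_add, Finset.prod_mul_distrib]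
      congr 1
      rw [Finset.prod_eq_single a, Finset.prod_eq_single b]
      · simp
      · intro j _ hj; simp [Ne.symm hj]
      · simp
      · intro i _ hi; simp [Ne.symm hi]
      · simp

theorem matrixBetaDensity_add (c k : Fin (n + 1) → Fin (n + 1) → ℕ) (hc : ∀ i j, 1 ≤ c i j)
    {M : Fin (n + 1) → Fin (n + 1) → ℝ} (hM : ∀ i j, 0 < M i j) :
    matrixBetaDensity c M * (monomialVal (fun i j => (k i j : ℤ)) M /
      ((matrixBetaConst fun i j => (c i j : ℝ) + k i j) / matrixBetaConst fun i j => (c i j : ℝ))) =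
      matrixBetaDensity (fun i j => c i j + k i j) M := by
  have hpos : 0 < matrixBetaConst fun i j => (c i j : ℝ) :=
    matrixBetaConst_pos fun i j => by exact_mod_cast hc i j
  have e : ∀ i j, ((c i j : ℤ) + (k i j : ℤ) - 1).toNat = c i j + k i j - 1 := fun i j => by omega
  rw [mul_div_assoc', matrixBetaDensity_mul_monomialVal hc
    (fun i j => by have := hc i j; omega) hM, matrixBetaDensity_eq]
  simp only [e, Nat.cast_add]
  field_simp

/-- The matrix beta distribution is conjugate to the transition counts. -/
theorem posterior_eq {θ : Fin (n + 1) → Fin (n + 1) → ℕ} (hθ : ∀ i j, 1 ≤ θ i j)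
    (q₀ : Fin (n + 1)) (w : List (Fin (n + 1))) :
    posterior (matrixBeta θ) q₀ (q₀ :: w) =
      matrixBeta fun i j => θ i j + edgeCount i j (q₀ :: w) := by
  set x := q₀ :: w
  set k : Fin (n + 1) → Fin (n + 1) → ℕ := fun i j => edgeCount i j x
  have hp : ∀ M, pathProb q₀ M x = monomialVal (fun i j => (k i j : ℤ)) M := fun M => by
    simp only [x, pathProb, if_true, transProd_eq, k]
  have hd : ∀ i j, 0 < (θ i j : ℤ) + (k i j : ℤ) := fun i j => by have := hθ i j; omega
  have hd' : ∀ i j, (0 : ℝ) < (θ i j : ℝ) + (k i j : ℝ) := fun i j => by exact_mod_cast hd i j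
  have hpos := matrixBetaConst_pos hd'
  have hpos' : 0 < matrixBetaConst fun i j => (θ i j : ℝ) :=
    matrixBetaConst_pos fun i j => by exact_mod_cast hθ i j
  have hnn : ∀ {M : Fin (n + 1) → Fin (n + 1) → ℝ}, (∀ i j, 0 < M i j) →
      0 ≤ monomialVal (fun i j => (k i j : ℤ)) M := fun hM =>
    Finset.prod_nonneg fun i _ => Finset.prod_nonneg fun j _ => zpow_nonneg (hM i j).le _
  -- The evidence is the prior moment whose exponents are the counts. It is positive and finite, so
  -- the quotient in Bayes' rule is one of real numbers.
  have hZ : ∫⁻ M, ENNReal.ofReal (pathProb q₀ M x) ∂matrixBeta θ =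
      ENNReal.ofReal ((matrixBetaConst fun i j => (θ i j : ℝ) + k i j) /
        matrixBetaConst fun i j => (θ i j : ℝ)) := by
    simp only [hp]
    rw [← ofReal_integral_eq_lintegral_ofReal (integrable_monomialVal hθ hd),
      integral_monomialVal hθ hd]
    · simp
    · filter_upwards [ae_pos_matrixBeta θ] with M hM using hnn hM
  rw [posterior, hZ]
  simp only [hp]
  rw [matrixBeta, ← withDensity_mul _ (measurable_matrixBetaDensity θ).ennreal_ofReal
    ((measurable_monomialVal _).ennreal_ofReal.div_const _), matrixBeta]
  refine withDensity_congr_ae ?_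
  filter_upwards [ae_pos_stochVolume] with M hM
  rw [Pi.mul_apply, ← ENNReal.ofReal_div_of_pos (by positivity),
    ← ENNReal.ofReal_mul (matrixBetaDensity_nonneg hθ hM), matrixBetaDensity_add θ k hθ hM]

end Moments

/-! ### Expressions and their polynomial forms -/

section Expressions

variable {n : ℕ}

theorem Monomial.measurable_eval {Q : Type} (ξ : Monomial Q) : Measurable ξ.eval := by
  induction ξ with
  | var i j => exact (measurable_pi_apply j).comp (measurable_pi_apply i)
  | mul ξ η h₁ h₂ => exact h₁.mul h₂
  | inv ξ h => exact h.const_div 1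

theorem PSE.measurable_eval {Q : Type} (φ : PSE Q) : Measurable φ.eval := by
  induction φ with
  | const κ => exact measurable_const
  | mono ξ => exact ξ.measurable_eval
  | add φ ψ h₁ h₂ => exact h₁.add h₂
  | sub φ ψ h₁ h₂ => exact h₁.sub h₂
  | mul φ ψ h₁ h₂ => exact h₁.mul h₂

theorem monomialVal_add (d e : Fin (n + 1) → Fin (n + 1) → ℤ)
    {M : Fin (n + 1) → Fin (n + 1) → ℝ} (hM : ∀ i j, 0 < M i j) :
    monomialVal (fun i j => d i j + e i j) M = monomialVal d M * monomialVal e M := by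
  simp only [monomialVal, ← Finset.prod_mul_distrib]
  exact Finset.prod_congr rfl fun i _ => Finset.prod_congr rfl fun j _ =>
    zpow_add₀ (hM i j).ne' _ _

/-- Positivity is essential: `v · (1 ÷ v)` evaluates to 0 at `v = 0`, whereas its exponent is 0 and
its monomial has value 1. -/
theorem Monomial.eval_eq (ξ : Monomial (Fin (n + 1)))
    {M : Fin (n + 1) → Fin (n + 1) → ℝ} (hM : ∀ i j, 0 < M i j) :
    ξ.eval M = monomialVal ξ.exponent M := by
  induction ξ with
  | var a b =>
    simp only [Monomial.eval, monomialVal, Monomial.exponent]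
    rw [Finset.prod_eq_single a, Finset.prod_eq_single b]
    · simp
    · intro j _ hj; simp [hj]
    · simp
    · intro i _ hi; simp [hi]
    · simp
  | mul ξ η h₁ h₂ =>
    rw [Monomial.eval, h₁, h₂, ← monomialVal_add _ _ hM]
    rfl
  | inv ξ h =>
    rw [Monomial.eval, h]
    simp only [monomialVal, Monomial.exponent, zpow_neg, Finset.prod_inv_distrib, one_div]

/-- The value of a polynomial form. -/
noncomputable def PolyForm.val (P : PolyForm (Fin (n + 1)))
    (M : Fin (n + 1) → Fin (n + 1) → ℝ) : ℝ :=
  (P.map fun t => t.1 * monomialVal t.2 M).sum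

theorem PSE.eval_eq (φ : PSE (Fin (n + 1)))
    {M : Fin (n + 1) → Fin (n + 1) → ℝ} (hM : ∀ i j, 0 < M i j) :
    φ.eval M = PolyForm.val φ.polyForm M := by
  induction φ with
  | const κ => simp [PSE.eval, PSE.polyForm, PolyForm.val, monomialVal]
  | mono ξ => simp [PSE.eval, PSE.polyForm, PolyForm.val, ξ.eval_eq hM]
  | add φ ψ h₁ h₂ =>
    rw [PSE.eval, h₁, h₂]
    simp [PSE.polyForm, PolyForm.val]
  | sub φ ψ h₁ h₂ =>
    rw [PSE.eval, h₁, h₂]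
    simp only [PSE.polyForm, PolyForm.val, List.map_append, List.sum_append, List.map_map,
      Function.comp_def, neg_mul, sub_eq_add_neg]
    congr 1
    induction ψ.polyForm with
    | nil => simp
    | cons t P ih => simp only [List.map_cons, List.sum_cons, neg_add, ih]
  | mul φ ψ h₁ h₂ =>
    rw [PSE.eval, h₁, h₂]
    simp only [PSE.polyForm, PolyForm.val]
    induction φ.polyForm with
    | nil => simp
    | cons s P ih =>
      rw [List.map_cons, List.sum_cons, add_mul, List.flatMap_cons, List.map_append,
        List.sum_append, ih, ← List.sum_map_mul_left, List.map_map]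
      congr 3
      funext t
      simp only [Function.comp_apply, monomialVal_add _ _ hM]
      ring

/-- The expectation of `∏_{i,j} M_{ij} ^ d_{ij}` under the matrix beta distribution with
parameter `c`. -/
noncomputable def betaMoment (c : Fin (n + 1) → Fin (n + 1) → ℕ)
    (d : Fin (n + 1) → Fin (n + 1) → ℤ) : ℝ :=
  (matrixBetaConst fun i j => (c i j : ℝ) + d i j) / matrixBetaConst fun i j => (c i j : ℝ)

theorem PolyForm.val_eq_sum (P : PolyForm (Fin (n + 1))) (M : Fin (n + 1) → Fin (n + 1) → ℝ) :
    PolyForm.val P M = ∑ l : Fin P.length, (P.get l).1 * monomialVal (P.get l).2 M := by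
  rw [PolyForm.val, ← Fin.sum_univ_fun_getElem]
  rfl

variable {c : Fin (n + 1) → Fin (n + 1) → ℕ}

theorem PolyForm.integrable_val (hc : ∀ i j, 1 ≤ c i j) {P : PolyForm (Fin (n + 1))}
    (hP : ∀ t ∈ P, ∀ i j, 0 < (c i j : ℤ) + t.2 i j) :
    Integrable (PolyForm.val P) (matrixBeta c) := by
  simp only [funext (PolyForm.val_eq_sum P)]
  exact integrable_finsetSum _ fun l _ =>
    (integrable_monomialVal hc (hP _ (P.get_mem l))).const_mul _

theorem PolyForm.integral_val (hc : ∀ i j, 1 ≤ c i j) {P : PolyForm (Fin (n + 1))}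
    (hP : ∀ t ∈ P, ∀ i j, 0 < (c i j : ℤ) + t.2 i j) :
    ∫ M, PolyForm.val P M ∂matrixBeta c =
      ∑ l : Fin P.length, (P.get l).1 * betaMoment c (P.get l).2 := by
  simp only [PolyForm.val_eq_sum]
  rw [integral_finsetSum _ fun l _ =>
    (integrable_monomialVal hc (hP _ (P.get_mem l))).const_mul _]
  refine Finset.sum_congr rfl fun l _ => ?_
  rw [integral_const_mul, integral_monomialVal hc (hP _ (P.get_mem l)), betaMoment]

theorem PSE.eval_ae_eq (φ : PSE (Fin (n + 1))) (c : Fin (n + 1) → Fin (n + 1) → ℕ) :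
    φ.eval =ᵐ[matrixBeta c] PolyForm.val φ.polyForm := by
  filter_upwards [ae_pos_matrixBeta c] with M hM using φ.eval_eq hM

theorem PSE.integrable_eval (φ : PSE (Fin (n + 1))) (hc : ∀ i j, 1 ≤ c i j)
    (hP : ∀ t ∈ φ.polyForm, ∀ i j, 0 < (c i j : ℤ) + t.2 i j) :
    Integrable φ.eval (matrixBeta c) :=
  (PolyForm.integrable_val hc hP).congr (φ.eval_ae_eq c).symm

theorem PSE.integral_eval (φ : PSE (Fin (n + 1))) (hc : ∀ i j, 1 ≤ c i j)
    (hP : ∀ t ∈ φ.polyForm, ∀ i j, 0 < (c i j : ℤ) + t.2 i j) :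
    ∫ M, φ.eval M ∂matrixBeta c =
      ∑ l : Fin φ.polyForm.length, (φ.polyForm.get l).1 * betaMoment c (φ.polyForm.get l).2 := by
  rw [integral_congr_ae (φ.eval_ae_eq c), PolyForm.integral_val hc hP]

theorem PSE.memLp_two_eval (φ : PSE (Fin (n + 1))) (hc : ∀ i j, 1 ≤ c i j)
    (hP : ∀ t ∈ (φ.mul φ).polyForm, ∀ i j, 0 < (c i j : ℤ) + t.2 i j) :
    MemLp φ.eval 2 (matrixBeta c) := by
  rw [memLp_two_iff_integrable_sq φ.measurable_eval.aestronglyMeasurable]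
  refine ((φ.mul φ).integrable_eval hc hP).congr (.of_forall fun M => ?_)
  simp only [PSE.eval, sq]

end Expressions

/-- Chebyshev's inequality, for confidence intervals. -/
theorem one_sub_le_measure_Icc {Ω : Type*} [MeasurableSpace Ω] {μ : Measure Ω}
    [IsProbabilityMeasure μ] {X : Ω → ℝ} (hXm : Measurable X) (hX : MemLp X 2 μ) {δ : ℝ}
    (hδ : 0 < δ) :
    ENNReal.ofReal (1 - δ) ≤
      μ {ω | X ω ∈ Set.Icc (μ[X] - √(variance X μ / δ)) (μ[X] + √(variance X μ / δ))} := by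
  set r := √(variance X μ / δ)
  have hV := variance_nonneg X μ
  -- Chebyshev's inequality needs a positive radius. For zero variance the interval is a point, but
  -- then `X` is almost surely equal to its mean.
  rcases hV.eq_or_lt with h0 | hpos
  · have h1 : ∀ᵐ ω ∂μ, X ω ∈ Set.Icc (μ[X] - r) (μ[X] + r) := by
      filter_upwards [ae_eq_integral_of_variance_eq_zero hX h0.symm] with ω hω
      have : 0 ≤ r := Real.sqrt_nonneg _
      rw [hω]
      constructor <;> linarith
    rw [show μ {ω | X ω ∈ Set.Icc (μ[X] - r) (μ[X] + r)} = 1 from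
      (prob_compl_eq_zero_iff (hXm measurableSet_Icc)).1 h1]
    exact ENNReal.ofReal_le_one.2 (by linarith)
  · have hr : 0 < r := Real.sqrt_pos.2 (by positivity)
    have hr2 : r ^ 2 = variance X μ / δ := Real.sq_sqrt (by positivity)
    have h := meas_ge_le_variance_div_sq hX hr
    rw [hr2, div_div_cancel₀ hpos.ne'] at h
    have hS : MeasurableSet {ω | X ω ∈ Set.Icc (μ[X] - r) (μ[X] + r)} := hXm measurableSet_Icc
    have hsub : {ω | X ω ∈ Set.Icc (μ[X] - r) (μ[X] + r)}ᶜ ⊆ {ω | r ≤ |X ω - μ[X]|} := by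
      intro ω hω
      by_contra hlt
      have := abs_lt.1 (not_le.1 (show ¬ r ≤ |X ω - μ[X]| from hlt))
      exact hω ⟨by linarith [this.1], by linarith [this.2]⟩
    have h2 := (measure_mono hsub).trans h
    rw [prob_compl_eq_one_sub hS] at h2
    rw [ENNReal.ofReal_sub _ hδ.le, ENNReal.ofReal_one, tsub_le_iff_left]
    exact tsub_le_iff_right.1 h2

/-! ### Values of terms -/

namespace Term

variable {R : Type} (v : R → ℕ)

@[simp] theorem eval_ofNat (k : ℕ) : (ofNat k : Term R).eval v = k := by
  induction k with
  | zero => rfl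
  | succ k ih => simp only [ofNat, eval, ih]

theorem eval_addInt (t : Term R) (z : ℤ) : (t.addInt z).eval v = ((t.eval v : ℤ) + z).toNat := by
  simp only [addInt, eval, eval_ofNat]
  omega

theorem eval_prod (l : List (Term R)) : (prod l).eval v = (l.map (eval v)).prod := by
  induction l with
  | nil => rfl
  | cons t l ih => simp only [prod, eval, ih, List.map_cons, List.prod_cons]

theorem eval_perm (t : Term R) (k : ℕ) : (t.perm k).eval v = (t.eval v).descFactorial k := by
  rw [perm, eval_prod, Nat.descFactorial_eq_prod_range, List.map_map]
  induction k with
  | zero => rfl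
  | succ k ih =>
    rw [List.range_succ, List.map_append, List.prod_append, ih, Finset.prod_range_succ]
    simp [eval]

theorem eval_rename {R' : Type} (f : R → R') (w : R' → ℕ) (t : Term R) :
    (t.rename f).eval w = t.eval (w ∘ f) := by
  induction t with
  | zero => rfl
  | one => rfl
  | reg r => rfl
  | add s t h₁ h₂ => simp only [rename, eval, h₁, h₂]
  | sub s t h₁ h₂ => simp only [rename, eval, h₁, h₂]
  | mul s t h₁ h₂ => simp only [rename, eval, h₁, h₂]
  | div s t h₁ h₂ => simp only [rename, eval, h₁, h₂]

end Term

theorem Atom.holds_rename {R R' : Type} (f : R → R') (w : R' → ℕ) (a : Atom R) :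
    (a.rename f).Holds w ↔ a.Holds (w ∘ f) := by
  cases a <;> simp only [Atom.rename, Atom.Holds, Term.eval_rename]

/-! ### Ratios of values of the Gamma function -/

section GammaRatio

variable {n : ℕ}

theorem descFactorial_eq_Gamma_div {c k : ℕ} (hc : 1 ≤ c) :
    ((c - 1 + k).descFactorial k : ℝ) = Real.Gamma ((c : ℝ) + k) / Real.Gamma c := by
  obtain ⟨a, rfl⟩ := Nat.exists_eq_add_of_le' hc
  have h := Nat.factorial_mul_descFactorial (n := a + k) (k := k) (by omega)
  rw [Nat.add_sub_cancel] at h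
  rw [show ((a + 1 : ℕ) : ℝ) + k = ((a + k : ℕ) : ℝ) + 1 by push_cast; ring,
    show ((a + 1 : ℕ) : ℝ) = (a : ℝ) + 1 from Nat.cast_succ a,
    Real.Gamma_nat_eq_factorial, Real.Gamma_nat_eq_factorial, Nat.add_sub_cancel, ← h,
    eq_div_iff (by positivity)]
  push_cast
  ring

/-- The factor `P(c - 1 + |z|, |z|)`, present for `z > 0`. -/
def posPerm (c : ℕ) (z : ℤ) : ℕ := if 0 < z then (c - 1 + z.natAbs).descFactorial z.natAbs else 1

/-- The factor `P(c - 1, |z|)`, present for `z < 0`. -/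
def negPerm (c : ℕ) (z : ℤ) : ℕ := if z < 0 then (c - 1).descFactorial z.natAbs else 1

theorem posPerm_div_negPerm {c : ℕ} {z : ℤ} (hc : 1 ≤ c) (hz : 0 < (c : ℤ) + z) :
    (posPerm c z : ℝ) / negPerm c z = Real.Gamma ((c : ℝ) + z) / Real.Gamma c := by
  rcases lt_trichotomy z 0 with h | rfl | h
  · obtain ⟨k, rfl⟩ : ∃ k : ℕ, z = -k := ⟨z.natAbs, by omega⟩
    rw [posPerm, negPerm, if_neg (by omega), if_pos h]
    -- A negative exponent is the positive case based at `c - k`, inverted; consistency is what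
    -- makes `c - k ≥ 1`.
    have e := descFactorial_eq_Gamma_div (c := c - k) (k := k) (by omega)
    rw [show c - k - 1 + k = c - 1 by omega, Nat.cast_sub (by omega), sub_add_cancel] at e
    rw [Int.natAbs_neg, Int.natAbs_natCast, e, Nat.cast_one, one_div_div]
    push_cast
    rw [sub_eq_add_neg]
  · have : Real.Gamma c ≠ 0 := (Real.Gamma_pos_of_pos (by exact_mod_cast hc)).ne'
    simp [posPerm, negPerm, this]
  · obtain ⟨k, rfl⟩ : ∃ k : ℕ, z = k := ⟨z.natAbs, by omega⟩
    rw [posPerm, negPerm, if_pos h, if_neg (by omega), Int.natAbs_natCast,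
      descFactorial_eq_Gamma_div hc]
    simp

/-- Only two Gamma values change, one entry and one row sum, both in row `q`; `Γ(x + 1) = x Γ(x)`
applies to each. -/
theorem matrixBetaConst_increment {c : Fin (n + 1) → Fin (n + 1) → ℝ} (hc : ∀ i j, 0 < c i j)
    (q s : Fin (n + 1)) :
    (matrixBetaConst fun i j => c i j + if i = q ∧ j = s then 1 else 0) =
      matrixBetaConst c * (c q s / ∑ j, c q j) := by
  have hr : 0 < ∑ j, c q j := Finset.sum_pos (fun j _ => hc q j) Finset.univ_nonempty
  have e : c q s / ∑ j, c q j = ∏ i, if i = q then c q s / ∑ j, c q j else 1 := by simp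
  rw [e, matrixBetaConst, matrixBetaConst, ← Finset.prod_mul_distrib]
  refine Finset.prod_congr rfl fun i _ => ?_
  by_cases hi : i = q
  · subst hi
    have e1 : ∏ j, Real.Gamma (c i j + if j = s then 1 else 0) =
        (∏ j, Real.Gamma (c i j)) * c i s := by
      have e2 : c i s = ∏ j, if j = s then c i s else 1 := by simp
      rw [e2, ← Finset.prod_mul_distrib]
      refine Finset.prod_congr rfl fun j _ => ?_
      by_cases hj : j = s
      · subst hj
        simp [Real.Gamma_add_one (hc i j).ne', mul_comm]
      · simp [hj]
    simp only [true_and, if_true, Finset.sum_add_distrib, Finset.sum_ite_eq', Finset.mem_univ]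
    rw [e1, Real.Gamma_add_one hr.ne']
    field_simp
  · simp [hi]

variable {c : Fin (n + 1) → Fin (n + 1) → ℕ} {d : Fin (n + 1) → Fin (n + 1) → ℤ}

theorem betaMoment_increment (hc : ∀ i j, 1 ≤ c i j) (hd : ∀ i j, 0 < (c i j : ℤ) + d i j)
    (q s : Fin (n + 1)) :
    betaMoment (fun i j => c i j + if i = q ∧ j = s then 1 else 0) d =
      betaMoment c d * ((((c q s : ℝ) + d q s) * ∑ j, (c q j : ℝ)) /
        (c q s * (∑ j, (c q j : ℝ) + ExpMonitor.rowExp d q))) := by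
  have hc' : ∀ i j, (0 : ℝ) < c i j := fun i j => by exact_mod_cast hc i j
  have hd' : ∀ i j, (0 : ℝ) < (c i j : ℝ) + d i j := fun i j => by exact_mod_cast hd i j
  have h1 := matrixBetaConst_increment hc' q s
  have h2 := matrixBetaConst_increment hd' q s
  have e1 : (matrixBetaConst fun i j => (((c i j + if i = q ∧ j = s then 1 else 0 : ℕ) : ℝ))) =
      matrixBetaConst fun i j => (c i j : ℝ) + if i = q ∧ j = s then 1 else 0 := by
    push_cast; rfl
  have e2 : (matrixBetaConst fun i j => (((c i j + if i = q ∧ j = s then 1 else 0 : ℕ) : ℝ)) + d i j)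
      = matrixBetaConst fun i j => (c i j : ℝ) + d i j + if i = q ∧ j = s then 1 else 0 := by
    push_cast
    congr 1
    funext i j
    ring
  have e3 : ∑ j, ((c q j : ℝ) + d q j) = ∑ j, (c q j : ℝ) + ExpMonitor.rowExp d q := by
    rw [Finset.sum_add_distrib, ExpMonitor.rowExp, Int.cast_sum]
  have p1 : 0 < ∑ j, (c q j : ℝ) := Finset.sum_pos (fun j _ => hc' q j) Finset.univ_nonempty
  have p2 : 0 < ∑ j, ((c q j : ℝ) + d q j) :=
    Finset.sum_pos (fun j _ => hd' q j) Finset.univ_nonempty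
  have p3 := matrixBetaConst_pos hc'
  have p4 := hc' q s
  rw [betaMoment, betaMoment, e1, e2, h1, h2, ← e3]
  field_simp

/-- Regrouped by argument, the moment is a product of ratios `Γ(c + z) / Γ(c)` over the entries,
divided by the same ratios over the row sums. Each is a falling factorial or its inverse, according
to the sign of `z`. -/
theorem betaMoment_eq (hc : ∀ i j, 1 ≤ c i j) (hd : ∀ i j, 0 < (c i j : ℤ) + d i j) :
    betaMoment c d =
      (((∏ i, ∏ j, posPerm (c i j) (d i j)) *
        ∏ i, negPerm (∑ j, c i j) (ExpMonitor.rowExp d i) : ℕ) : ℝ) /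
      (((∏ i, posPerm (∑ j, c i j) (ExpMonitor.rowExp d i)) *
        ∏ i, ∏ j, negPerm (c i j) (d i j) : ℕ) : ℝ) := by
  have hr : ∀ i, 1 ≤ ∑ j, c i j := fun i =>
    Nat.succ_le_of_lt (Finset.sum_pos (fun j _ => hc i j) Finset.univ_nonempty)
  have hrd : ∀ i, 0 < ((∑ j, c i j : ℕ) : ℤ) + ExpMonitor.rowExp d i := fun i => by
    rw [ExpMonitor.rowExp, Nat.cast_sum, ← Finset.sum_add_distrib]
    exact Finset.sum_pos (fun j _ => hd i j) Finset.univ_nonempty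
  push_cast
  rw [← div_div_div_eq, ← Finset.prod_div_distrib, ← Finset.prod_div_distrib,
    ← Finset.prod_div_distrib, betaMoment, matrixBetaConst, matrixBetaConst,
    ← Finset.prod_div_distrib]
  refine Finset.prod_congr rfl fun i _ => ?_
  have h := posPerm_div_negPerm (hr i) (hrd i)
  have h' : (∏ j, (posPerm (c i j) (d i j) : ℝ)) / ∏ j, (negPerm (c i j) (d i j) : ℝ) =
      (∏ j, Real.Gamma ((c i j : ℝ) + d i j)) / ∏ j, Real.Gamma (c i j : ℝ) := by
    rw [← Finset.prod_div_distrib, ← Finset.prod_div_distrib]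
    exact Finset.prod_congr rfl fun j _ => posPerm_div_negPerm (hc i j) (hd i j)
  rw [div_div_div_comm, div_div_div_comm (∏ j, (posPerm (c i j) (d i j) : ℝ)), h', h]
  congr 3
  · rw [Finset.sum_add_distrib, ExpMonitor.rowExp, Int.cast_sum, Nat.cast_sum]
  · rw [Nat.cast_sum]

end GammaRatio

/-! ### Values of the terms for `H` and of the incremented counters -/

theorem prod_map_filter {α : Type*} (l : List α) (p : α → Prop) [DecidablePred p] (f : α → ℕ) :
    ((l.filter fun a => p a).map f).prod = (l.map fun a => if p a then f a else 1).prod := by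
  induction l with
  | nil => rfl
  | cons a l ih =>
    by_cases h : p a
    · simp [h, ih]
    · simp [h, ih]

namespace ExpMonitor

variable {n p : ℕ}

theorem eval_numH {R : Type} (d : Fin (n + 1) → Fin (n + 1) → ℤ)
    (c : Fin (n + 1) → Fin (n + 1) → Term R) (r : Fin (n + 1) → Term R) (v : R → ℕ) :
    (numH d c r).eval v = (∏ i, ∏ j, posPerm ((c i j).eval v) (d i j)) *
      ∏ i, negPerm ((r i).eval v) (rowExp d i) := by
  simp only [numH, Term.eval, Term.eval_prod, List.map_map, Function.comp_def, Term.eval_perm,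
    Term.eval_ofNat, prod_map_filter, Fin.prod_univ_def, posPerm, negPerm]

theorem eval_denH {R : Type} (d : Fin (n + 1) → Fin (n + 1) → ℤ)
    (c : Fin (n + 1) → Fin (n + 1) → Term R) (r : Fin (n + 1) → Term R) (v : R → ℕ) :
    (denH d c r).eval v = (∏ i, posPerm ((r i).eval v) (rowExp d i)) *
      ∏ i, ∏ j, negPerm ((c i j).eval v) (d i j) := by
  simp only [denH, Term.eval, Term.eval_prod, List.map_map, Function.comp_def, Term.eval_perm,
    Term.eval_ofNat, prod_map_filter, Fin.prod_univ_def, posPerm, negPerm]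

theorem eval_cntNext (v : ExpReg n p → ℕ) (q s i j : Fin (n + 1)) :
    (cntNext q s i j).eval v = v (.cnt i j) + if i = q ∧ j = s then 1 else 0 := by
  unfold cntNext
  split_ifs <;> rfl

theorem eval_rowNext (v : ExpReg n p → ℕ) (q i : Fin (n + 1)) :
    (rowNext q i).eval v = v (.row i) + if i = q then 1 else 0 := by
  unfold rowNext
  split_ifs <;> rfl

end ExpMonitor

/-! ### Deterministic runs -/

namespace RegisterMonitor

variable {S L : Type} {A : RegisterMonitor S L}

theorem step_eq_pure {s : S} {v : A.R → ℕ} {τ : Test A.R} {γ : Update A.R}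
    (hτ : Test.Holds v τ) (hs : A.trans s τ = some (PMF.pure γ)) :
    A.step s v = PMF.pure (γ.apply v) := by
  have h : (A.unique s v).choose = τ :=
    (A.unique s v).unique (A.unique s v).choose_spec.1 ⟨hτ, by rw [hs]; rfl⟩
  have hγ : ∀ h', (A.trans s (A.unique s v).choose).get h' = PMF.pure γ := by
    rw [h, hs]
    exact fun _ => rfl
  rw [step, hγ, PMF.pure_map]

theorem run_cons_of_step {s : S} {v v' : A.R → ℕ} (h : A.step s v = PMF.pure v') (w : List S) :
    A.run (s :: w) v = A.run w v' := by
  rw [run, h, PMF.pure_bind]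

theorem semantics_of_run {w : List S} {v : A.R → ℕ} (h : (A.run w fun _ => 0) = PMF.pure v) :
    A.semantics w = PMF.pure (A.out v) := by
  rw [semantics, h, PMF.pure_map]

end RegisterMonitor

open Classical in
theorem tableMonitor_step {S L R ι : Type} [Finite R] [Fintype ι] (out : (R → ℕ) → L)
    (at_ : S → ι → Atom R) (upd : S → (ι → Bool) → Update R) (s : S) (v : R → ℕ) :
    (tableMonitor out at_ upd).step s v =
      PMF.pure (Update.apply (upd s fun k => decide ((at_ s k).Holds v)) v) := by
  set b : ι → Bool := fun k => decide ((at_ s k).Holds v) with hb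
  have hτ : Test.Holds v (tableTest (at_ s) b) := by
    rw [tableTest_holds]
    simp [hb]
  have hex : ∃ b', tableTest (at_ s) b = tableTest (at_ s) b' := ⟨b, rfl⟩
  -- A table test fixes the truth value of every atom, so any vector whose test holds at `v` is the
  -- actual one, whichever `choose` picks.
  have hc : hex.choose = b := by
    have h1 : Test.Holds v (tableTest (at_ s) hex.choose) := hex.choose_spec ▸ hτ
    rw [tableTest_holds] at h1
    funext k
    rw [Bool.eq_iff_iff, h1 k, hb, decide_eq_true_eq]
  refine RegisterMonitor.step_eq_pure (A := tableMonitor out at_ upd) hτ ?_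
  refine (dif_pos hex).trans ?_
  rw [hc]
  rfl

/-- `edgeCount` recurses from the front of the word, while the monitor reads at its end. -/
theorem edgeCount_append_singleton {Q : Type} [DecidableEq Q] (i j q s : Q) (w : List Q) :
    edgeCount i j (w ++ [q] ++ [s]) =
      edgeCount i j (w ++ [q]) + if i = q ∧ j = s then 1 else 0 := by
  induction w with
  | nil => simp [edgeCount, eq_comm]
  | cons a w ih =>
    cases w with
    | nil => simp [edgeCount, eq_comm]
    | cons b w =>
      simp only [List.cons_append, edgeCount] at ih ⊢
      rw [ih, add_assoc]

/-! ### Correctness of `BayesExpMonitor` -/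

namespace ExpMonitor

variable {n p : ℕ}

open Classical in
/-- One step of `BayesExpMonitor` on the valuations of its registers. -/
noncomputable def next (θ : Fin (n + 1) → Fin (n + 1) → ℕ)
    (d : Fin p → Fin (n + 1) → Fin (n + 1) → ℤ) (v : ExpReg n p → ℕ) (s : Fin (n + 1)) :
    ExpReg n p → ℕ :=
  Update.apply (update θ d s fun k => decide ((atoms d s k).Holds v)) v

theorem next_init (θ : Fin (n + 1) → Fin (n + 1) → ℕ)
    (d : Fin p → Fin (n + 1) → Fin (n + 1) → ℤ) {v : ExpReg n p → ℕ} (hv : v .prev = 0)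
    (s : Fin (n + 1)) : next θ d v s = Update.apply (initUpdate θ s) v := by
  rw [next, update, dif_neg]
  -- States are stored shifted by one, so the starting value 0 matches none of them.
  rintro ⟨q, hq⟩
  simp [atoms, Atom.Holds, Term.eval, hv] at hq

open Classical in
theorem next_eq (θ : Fin (n + 1) → Fin (n + 1) → ℕ)
    (d : Fin p → Fin (n + 1) → Fin (n + 1) → ℤ) {v : ExpReg n p → ℕ} {q : Fin (n + 1)}
    (hv : v .prev = q + 1) (s : Fin (n + 1)) :
    next θ d v s = Update.apply (nextUpdate d q s (decide (v .active = 1))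
      (decide (∀ i j, (∃ l, d l i j ≠ 0) →
        0 < (((cntNext q s i j).eval v : ℕ) : ℤ) + minExp d i j))) v := by
  have hex : ∃ q, (fun k => decide ((atoms d s k).Holds v)) (.prevIs q) = true :=
    ⟨q, by simp [atoms, Atom.Holds, Term.eval, hv]⟩
  have hq : hex.choose = q := by
    have h1 : v .prev = (Term.ofNat (hex.choose.val + 1)).eval v :=
      (decide_eq_true_eq (p := (atoms d s (.prevIs hex.choose)).Holds v)).mp hex.choose_spec
    rw [Term.eval_ofNat, hv] at h1
    exact Fin.ext (by omega)
  rw [next, update, dif_pos hex, hq]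
  have e : ∀ i j, (atoms d s (.consistent q i j)).Holds v ↔
      0 < (((cntNext q s i j).eval v : ℕ) : ℤ) + minExp d i j := fun i j => by
    simp only [atoms, Atom.Holds, Term.eval, Term.eval_addInt]
    omega
  have e' : (atoms d s .isActive).Holds v ↔ v .active = 1 := Iff.rfl
  simp only [decide_eq_true_eq, e, e']

/-- The minimum over the finitely many summands is attained. Entries whose variable never occurs
need no test, since there `d = 0` and `c ≥ 1`. -/
theorem forall_minExp_iff (d : Fin p → Fin (n + 1) → Fin (n + 1) → ℤ)
    {c : Fin (n + 1) → Fin (n + 1) → ℕ} (hc : ∀ i j, 1 ≤ c i j) :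
    (∀ i j, (∃ l, d l i j ≠ 0) → 0 < (c i j : ℤ) + minExp d i j) ↔
      ∀ l i j, 0 < (c i j : ℤ) + d l i j := by
  constructor
  · intro h l i j
    by_cases h0 : d l i j = 0
    · have := hc i j; omega
    · have h1 := h i j ⟨l, h0⟩
      have h2 : minExp d i j ≤ d l i j := ciInf_le (Set.finite_range _).bddBelow l
      omega
  · rintro h i j ⟨l, -⟩
    have : Nonempty (Fin p) := ⟨l⟩
    obtain ⟨m, hm⟩ := exists_eq_ciInf_of_finite (f := fun l => d l i j)
    rw [minExp, ← hm]
    exact h m i j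

/-- The registers of `BayesExpMonitor` when the transition counts plus `θ` are `c`, the last
symbol is `q`, and `k` symbols have been read. -/
structure Invariant (d : Fin p → Fin (n + 1) → Fin (n + 1) → ℤ) (c : Fin (n + 1) → Fin (n + 1) → ℕ)
    (q : Fin (n + 1)) (k : ℕ) (v : ExpReg n p → ℕ) : Prop where
  prev : v .prev = q + 1
  cnt : ∀ i j, v (.cnt i j) = c i j
  row : ∀ i, v (.row i) = ∑ j, c i j
  active : v .active = 1 ↔ 2 ≤ k ∧ ∀ l i j, 0 < (c i j : ℤ) + d l i j
  ratio : v .active = 1 → ∀ l, (v (.num l) : ℝ) / v (.den l) = betaMoment c (d l)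

theorem invariant_init (θ : Fin (n + 1) → Fin (n + 1) → ℕ)
    (d : Fin p → Fin (n + 1) → Fin (n + 1) → ℤ) (q : Fin (n + 1)) :
    Invariant d θ q 1 (next θ d (fun _ => 0) q) := by
  rw [next_init θ d rfl]
  -- After one symbol `active` is 0, in accordance with `2 ≤ k` failing at `k = 1`, so the ratio
  -- clause is vacuous.
  constructor <;> simp [Update.apply, initUpdate, Term.eval]

theorem Invariant.next {θ : Fin (n + 1) → Fin (n + 1) → ℕ}
    {d : Fin p → Fin (n + 1) → Fin (n + 1) → ℤ} {c : Fin (n + 1) → Fin (n + 1) → ℕ}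
    (hc : ∀ i j, 1 ≤ c i j) {q : Fin (n + 1)} {k : ℕ} (hk : 1 ≤ k) {v : ExpReg n p → ℕ}
    (h : Invariant d c q k v) (s : Fin (n + 1)) :
    Invariant d (fun i j => c i j + if i = q ∧ j = s then 1 else 0) s (k + 1)
      (next θ d v s) := by
  classical
  set c' : Fin (n + 1) → Fin (n + 1) → ℕ := fun i j => c i j + if i = q ∧ j = s then 1 else 0
    with hc'
  have hcc' : ∀ i j, c i j ≤ c' i j := fun i j => Nat.le_add_right _ _
  have hc1 : ∀ i j, 1 ≤ c' i j := fun i j => (hc i j).trans (hcc' i j)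
  have hcnt : ∀ i j, (cntNext q s i j).eval v = c' i j := fun i j => by
    rw [eval_cntNext, h.cnt]
  have hrow : ∀ i, (rowNext q i).eval v = ∑ j, c' i j := fun i => by
    rw [eval_rowNext, h.row, hc', Finset.sum_add_distrib]
    by_cases hi : i = q <;> simp [hi]
  -- Counters only grow, so an active monitor stays consistent.
  have hact : v .active = 1 → ∀ l i j, 0 < (c' i j : ℤ) + d l i j := fun ha l i j => by
    have := (h.active.1 ha).2 l i j
    have := hcc' i j
    omega
  rw [next_eq θ d h.prev]
  simp only [hcnt, forall_minExp_iff d hc1]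
  by_cases ha : v .active = 1
  · have hC := hact ha
    rw [decide_eq_true ha, decide_eq_true hC]
    refine ⟨by simp [Update.apply, nextUpdate], hcnt, hrow,
      ?_, fun _ l => ?_⟩
    · simp only [Update.apply, nextUpdate, Bool.or_self, if_true, Term.eval, true_iff]
      exact ⟨by omega, hC⟩
    · simp only [Update.apply, nextUpdate, if_true, Term.eval, Term.eval_addInt, hcnt, hrow]
      have hd := (h.active.1 ha).2 l
      -- The update subtracts one from the new counters, recovering the old ones in which
      -- `betaMoment_increment` is stated.
      have h1 : c' q s - 1 = c q s := by simp [hc']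
      have h2 : ∑ j, c' q j - 1 = ∑ j, c q j := by
        simp [hc', Finset.sum_add_distrib]
      have hrd : 0 < ((∑ j, c q j : ℕ) : ℤ) + rowExp (d l) q := by
        rw [rowExp, Nat.cast_sum, ← Finset.sum_add_distrib]
        exact Finset.sum_pos (fun j _ => hd q j) Finset.univ_nonempty
      -- By consistency of the old counters, the truncated terms equal the integers they stand for.
      have e : ∀ {z : ℤ}, 0 < z → ((z.toNat : ℕ) : ℝ) = (z : ℝ) := fun hz => by
        exact_mod_cast congrArg (Int.cast : ℤ → ℝ) (Int.toNat_of_nonneg hz.le)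
      rw [h1, h2, betaMoment_increment hc hd q s, ← h.ratio ha l, Nat.cast_mul, Nat.cast_mul,
        Nat.cast_mul, Nat.cast_mul, e (hd q s), e hrd, mul_div_mul_comm]
      push_cast
      rfl
  -- An inactive monitor either becomes active now and computes the moments from scratch, or remains
  -- inactive.
  · by_cases hC : ∀ l i j, 0 < (c' i j : ℤ) + d l i j
    · rw [decide_eq_false ha, decide_eq_true hC]
      refine ⟨by simp [Update.apply, nextUpdate], hcnt, hrow,
        ?_, fun _ l => ?_⟩
      · simp only [Update.apply, nextUpdate, Bool.or_true, if_true, Term.eval, true_iff]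
        exact ⟨by omega, hC⟩
      · simp only [Update.apply, nextUpdate, if_true, Bool.false_eq_true, if_false, eval_numH,
          eval_denH, hcnt, hrow]
        rw [betaMoment_eq hc1 (hC l)]
    · rw [decide_eq_false ha, decide_eq_false hC]
      refine ⟨by simp [Update.apply, nextUpdate], hcnt, hrow,
        ?_, fun h1 => ?_⟩
      · simp [Update.apply, nextUpdate, Term.eval, hC]
      · simp [Update.apply, nextUpdate, Term.eval] at h1

theorem invariant_run {θ : Fin (n + 1) → Fin (n + 1) → ℕ} (hθ : ∀ i j, 1 ≤ θ i j)
    (d : Fin p → Fin (n + 1) → Fin (n + 1) → ℤ) (w : List (Fin (n + 1))) (q : Fin (n + 1)) :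
    Invariant d (fun i j => θ i j + edgeCount i j (w ++ [q])) q (w ++ [q]).length
      ((w ++ [q]).foldl (ExpMonitor.next θ d) fun _ => 0) := by
  induction w using List.reverseRecOn generalizing q with
  | nil => exact invariant_init θ d q
  | append_singleton w s ih =>
    have h := (ih s).next (θ := θ) (fun i j => (hθ i j).trans (Nat.le_add_right _ _)) (by simp) q
    rw [List.foldl_append, List.length_append, List.foldl_cons, List.foldl_nil,
      List.length_singleton]
    simpa only [edgeCount_append_singleton, ← add_assoc] using h

/-- The value of `BayesExpMonitor` for a polynomial form. -/
theorem value_run {θ : Fin (n + 1) → Fin (n + 1) → ℕ} (hθ : ∀ i j, 1 ≤ θ i j)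
    (P : PolyForm (Fin (n + 1))) {x : List (Fin (n + 1))} (hx : x ≠ []) :
    (2 ≤ x.length ∧ Consistent θ P x →
      value P (x.foldl (next θ fun l => (P.get l).2) fun _ => 0) =
        some (∑ l : Fin P.length, (P.get l).1 *
          betaMoment (fun i j => θ i j + edgeCount i j x) (P.get l).2)) ∧
    (¬ (2 ≤ x.length ∧ Consistent θ P x) →
      value P (x.foldl (next θ fun l => (P.get l).2) fun _ => 0) = none) := by
  obtain ⟨w, q, rfl⟩ : ∃ w q, x = w ++ [q] := ⟨_, _, (List.dropLast_append_getLast hx).symm⟩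
  have h := invariant_run hθ (fun l => (P.get l).2) w q
  have hC : (∀ l : Fin P.length, ∀ i j, 0 < ((θ i j + edgeCount i j (w ++ [q]) : ℕ) : ℤ) +
      (P.get l).2 i j) ↔ Consistent θ P (w ++ [q]) := by
    rw [Consistent, List.forall_mem_iff_get]
    refine forall_congr' fun l => forall_congr' fun i => forall_congr' fun j => ?_
    rw [Nat.cast_add, add_comm (θ i j : ℤ)]
  have ha := h.active
  rw [hC] at ha
  constructor
  · intro hr
    rw [value, if_pos (ha.2 hr)]
    simp only [h.ratio (ha.2 hr)]
  · intro hr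
    rw [value, if_neg fun h1 => hr (ha.1 h1)]

end ExpMonitor

/-! ### The run of `BayesConfIntMonitor` -/

section ConfInt

variable {n : ℕ}

/-- The two halves use disjoint registers and conditions, so a joint step is the pair of separate
steps. Arbitrary starting valuations are needed for the induction. -/
theorem bayesConfIntMonitor_run (φ : PSE (Fin (n + 1))) (θ : Fin (n + 1) → Fin (n + 1) → ℕ) (δ : ℝ)
    (x : List (Fin (n + 1))) (v : ExpReg n φ.polyForm.length → ℕ)
    (v₂ : ExpReg n (φ.mul φ).polyForm.length → ℕ) :
    (bayesConfIntMonitor φ θ δ).run x (Sum.elim v v₂) =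
      PMF.pure (Sum.elim (x.foldl (ExpMonitor.next θ fun l => (φ.polyForm.get l).2) v)
        (x.foldl (ExpMonitor.next θ fun l => ((φ.mul φ).polyForm.get l).2) v₂)) := by
  classical
  induction x generalizing v v₂ with
  | nil => rfl
  | cons s x ih =>
    have hs : (bayesConfIntMonitor φ θ δ).step s (Sum.elim v v₂) =
        PMF.pure (Sum.elim (ExpMonitor.next θ (fun l => (φ.polyForm.get l).2) v s)
          (ExpMonitor.next θ (fun l => ((φ.mul φ).polyForm.get l).2) v₂ s)) := by
      refine (tableMonitor_step _ _ _ s _).trans ?_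
      congr 1
      funext r
      rcases r with r | r
      · simp only [Update.apply, Sum.elim_inl, Term.eval_rename, Function.comp_def,
          Atom.holds_rename, ExpMonitor.next]
      · simp only [Update.apply, Sum.elim_inl, Sum.elim_inr, Term.eval_rename, Function.comp_def,
          Atom.holds_rename, ExpMonitor.next]
    exact (RegisterMonitor.run_cons_of_step hs x).trans (ih _ _)

theorem bayesConfIntMonitor_semantics (φ : PSE (Fin (n + 1)))
    (θ : Fin (n + 1) → Fin (n + 1) → ℕ) (δ : ℝ) (x : List (Fin (n + 1))) :
    (bayesConfIntMonitor φ θ δ).semantics x = PMF.pure (confInt δ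
      (ExpMonitor.value φ.polyForm
        (x.foldl (ExpMonitor.next θ fun l => (φ.polyForm.get l).2) fun _ => 0))
      (ExpMonitor.value (φ.mul φ).polyForm
        (x.foldl (ExpMonitor.next θ fun l => ((φ.mul φ).polyForm.get l).2) fun _ => 0))) := by
  have h := bayesConfIntMonitor_run φ θ δ x (fun _ => 0) (fun _ => 0)
  have e : (Sum.elim (fun _ => 0) (fun _ => 0) :
      ExpReg n φ.polyForm.length ⊕ ExpReg n (φ.mul φ).polyForm.length → ℕ) = fun _ => 0 := by
    funext r; cases r <;> rfl
  rw [e] at h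
  exact RegisterMonitor.semantics_of_run h

theorem semantics_of_not_ready {θ : Fin (n + 1) → Fin (n + 1) → ℕ} (hθ : ∀ i j, 1 ≤ θ i j)
    (φ : PSE (Fin (n + 1))) (δ : ℝ) {x : List (Fin (n + 1))} (hx : x ≠ []) (h : ¬ Ready θ φ x) :
    (bayesConfIntMonitor φ θ δ).semantics x = PMF.pure none := by
  rw [bayesConfIntMonitor_semantics]
  by_cases h1 : 2 ≤ x.length ∧ Consistent θ φ.polyForm x
  · have h2 : ¬ (2 ≤ x.length ∧ Consistent θ (φ.mul φ).polyForm x) :=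
      fun h2 => h ⟨h1.1, h1.2, h2.2⟩
    rw [(ExpMonitor.value_run hθ _ hx).2 h2, (ExpMonitor.value_run hθ _ hx).1 h1]
    rfl
  · rw [(ExpMonitor.value_run hθ _ hx).2 h1]
    rfl

theorem Consistent.pos {θ : Fin (n + 1) → Fin (n + 1) → ℕ} {P : PolyForm (Fin (n + 1))}
    {x : List (Fin (n + 1))} (h : Consistent θ P x) :
    ∀ t ∈ P, ∀ i j, 0 < ((θ i j + edgeCount i j x : ℕ) : ℤ) + t.2 i j := fun t ht i j => by
  have := h t ht i j
  push_cast
  linarith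

theorem semantics_of_ready {θ : Fin (n + 1) → Fin (n + 1) → ℕ} (hθ : ∀ i j, 1 ≤ θ i j)
    (φ : PSE (Fin (n + 1))) (δ : ℝ) {x : List (Fin (n + 1))} (hx : x ≠ []) (h : Ready θ φ x)
    {μ : Measure (Fin (n + 1) → Fin (n + 1) → ℝ)}
    (hμ : μ = matrixBeta fun i j => θ i j + edgeCount i j x) :
    (bayesConfIntMonitor φ θ δ).semantics x = PMF.pure (some
      (∫ M, φ.eval M ∂μ - √(variance φ.eval μ / δ),
        ∫ M, φ.eval M ∂μ + √(variance φ.eval μ / δ))) := by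
  have hc : ∀ i j, 1 ≤ θ i j + edgeCount i j x := fun i j => (hθ i j).trans (Nat.le_add_right _ _)
  have : IsProbabilityMeasure μ := hμ ▸ isProbabilityMeasure_matrixBeta hc
  have hL : MemLp φ.eval 2 μ := hμ ▸ φ.memLp_two_eval hc h.2.2.pos
  -- Consistency for `φ²` gives square-integrability, so the radicand `E₂ - E²` is the variance.
  have hV : variance φ.eval μ = ∫ M, (φ.mul φ).eval M ∂μ - (∫ M, φ.eval M ∂μ) ^ 2 := by
    rw [variance_eq_sub hL]
    simp only [PSE.eval, ← sq, Pi.pow_apply]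
  rw [bayesConfIntMonitor_semantics, (ExpMonitor.value_run hθ _ hx).1 ⟨h.1, h.2.1⟩,
    (ExpMonitor.value_run hθ _ hx).1 ⟨h.1, h.2.2⟩, confInt, ← φ.integral_eval hc h.2.1.pos,
    ← (φ.mul φ).integral_eval hc h.2.2.pos, ← hμ, hV]

theorem coverProb_of_semantics_eq_pure (μ : Measure (Fin (n + 1) → Fin (n + 1) → ℝ))
    (q₀ : Fin (n + 1)) (φ : PSE (Fin (n + 1))) {A : RegisterMonitor (Fin (n + 1)) Verdict}
    {x : List (Fin (n + 1))} {I : Verdict} (h : A.semantics x = PMF.pure I) :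
    coverProb μ q₀ φ A x = posterior μ q₀ x {M | φ.eval M ∈ I.toSet} := by
  rw [coverProb, h, tsum_eq_single I]
  · simp
  · intro J hJ
    simp [PMF.pure_apply, hJ]

/-- At time 0 the marginal is the point mass at `q₀`, so positivity forces the first symbol. -/
theorem MarkovChain.IsPath.eq_cons {C : MarkovChain (n + 1)} {q₀ : Fin (n + 1)}
    (hC : C.StartsAt q₀) {x : List (Fin (n + 1))} (hx : C.IsPath x) : ∃ w, x = q₀ :: w := by
  obtain ⟨hne, hpos⟩ := hx
  cases x with
  | nil => exact absurd rfl hne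
  | cons a w =>
    have h := hpos 0 (by simp)
    have ha : a = q₀ := by
      by_contra hne
      rw [MarkovChain.marginal, hC] at h
      simp [hne] at h
    exact ⟨w, by rw [ha]⟩

end ConfInt

end BayesMonitor

/-! ### The monitoring theorem -/

open BayesMonitor in
theorem mainTheorem1 {n : ℕ} (θ : Fin (n + 1) → Fin (n + 1) → ℕ) (hθ : ∀ i j, 1 ≤ θ i j)
    (q₀ : Fin (n + 1)) (φ : PSE (Fin (n + 1))) (δ : ℝ) (hδ₀ : 0 < δ) (hδ₁ : δ ≤ 1) :
    IsProbabilityMeasure (matrixBeta θ) ∧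
    SolvesBayesianMonitoring (matrixBeta θ) q₀ φ δ (bayesConfIntMonitor φ θ δ) ∧
    ∀ C : MarkovChain (n + 1), C.StartsAt q₀ → ∀ x : List (Fin (n + 1)), C.IsPath x →
      IsProbabilityMeasure (posterior (matrixBeta θ) q₀ x) ∧
      (¬ Ready θ φ x → (bayesConfIntMonitor φ θ δ).semantics x = PMF.pure none) ∧
      (Ready θ φ x →
        MemLp φ.eval 2 (posterior (matrixBeta θ) q₀ x) ∧
        ∃ E r : ℝ,
          E = ∫ M, φ.eval M ∂(posterior (matrixBeta θ) q₀ x) ∧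
          r = √(variance φ.eval (posterior (matrixBeta θ) q₀ x) / δ) ∧
          (bayesConfIntMonitor φ θ δ).semantics x = PMF.pure (some (E - r, E + r)) ∧
          ENNReal.ofReal (1 - δ) ≤
            posterior (matrixBeta θ) q₀ x {M | φ.eval M ∈ Set.Icc (E - r) (E + r)}) := by
  have main : ∀ C : MarkovChain (n + 1), C.StartsAt q₀ → ∀ x : List (Fin (n + 1)), C.IsPath x →
      IsProbabilityMeasure (posterior (matrixBeta θ) q₀ x) ∧
      (¬ Ready θ φ x → (bayesConfIntMonitor φ θ δ).semantics x = PMF.pure none) ∧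
      (Ready θ φ x →
        MemLp φ.eval 2 (posterior (matrixBeta θ) q₀ x) ∧
        ∃ E r : ℝ,
          E = ∫ M, φ.eval M ∂(posterior (matrixBeta θ) q₀ x) ∧
          r = √(variance φ.eval (posterior (matrixBeta θ) q₀ x) / δ) ∧
          (bayesConfIntMonitor φ θ δ).semantics x = PMF.pure (some (E - r, E + r)) ∧
          ENNReal.ofReal (1 - δ) ≤
            posterior (matrixBeta θ) q₀ x {M | φ.eval M ∈ Set.Icc (E - r) (E + r)}) := by
    intro C hC x hx
    have hne := hx.1
    have hpost : posterior (matrixBeta θ) q₀ x =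
        matrixBeta fun i j => θ i j + edgeCount i j x := by
      obtain ⟨w, rfl⟩ := hx.eq_cons hC
      exact posterior_eq hθ q₀ w
    have hc : ∀ i j, 1 ≤ θ i j + edgeCount i j x :=
      fun i j => (hθ i j).trans (Nat.le_add_right _ _)
    have hprob : IsProbabilityMeasure (posterior (matrixBeta θ) q₀ x) :=
      hpost ▸ isProbabilityMeasure_matrixBeta hc
    refine ⟨hprob, semantics_of_not_ready hθ φ δ hne, fun hr => ?_⟩
    have hL : MemLp φ.eval 2 (posterior (matrixBeta θ) q₀ x) :=
      hpost ▸ φ.memLp_two_eval hc hr.2.2.pos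
    exact ⟨hL, _, _, rfl, rfl, semantics_of_ready hθ φ δ hne hr hpost,
      one_sub_le_measure_Icc φ.measurable_eval hL hδ₀⟩
  refine ⟨isProbabilityMeasure_matrixBeta hθ, fun C hC x hx => ?_, main⟩
  obtain ⟨hprob, h0, h1⟩ := main C hC x hx
  by_cases hr : Ready θ φ x
  · obtain ⟨-, E, r, -, -, hs, hle⟩ := h1 hr
    rw [coverProb_of_semantics_eq_pure _ _ _ hs]
    exact hle
  -- The verdict `⊥` admits every value, so coverage has the full posterior mass 1.
  · rw [coverProb_of_semantics_eq_pure _ _ _ (h0 hr)]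
    simp only [Verdict.toSet, Set.mem_univ]
    rw [show {M : Fin (n + 1) → Fin (n + 1) → ℝ | True} = Set.univ from Set.eq_univ_of_forall
      fun _ => trivial, measure_univ]
    exact ENNReal.ofReal_le_one.2 (by linarith)
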